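/- Let $h\ge 1$ and let $m_0,m_1,\dots,m_{h-1}$ be integers with $m_i\ge 3$ for all $0\le i<h$. Let $T^1=T^1_{m_0,\dots,m_{h-1}}$ be the level-wise regular tree with one root $w$ and height $h$: the finite tree in which the maximum distance from $w$ is $h$ and, for each $0\le i<h$, every vertex at distance $i$ from $w$ has degree $m_i$. Let $T^2=T^2_{m_0,\dots,m_{h-1}}$ be the level-wise regular tree with two adjacent roots $w,w'$ and height $h$: the finite tree in which the maximum over all vertices $v$ of $\min\{d(v,w),d(v,w')\}$ is $h$ and, for each $0\le i<h$, every vertex $v$ with $\min\{d(v,w),d(v,w')\}=i$ has degree $m_i$. For a connected graph $G$ with diameter $d(G)$, a radio labeling is a map $f:V(G)\to\{0,1,2,\dots\}$ with $|f(u)-f(v)|\ge d(G)+1-d(u,v)$ for all distinct $u,v$, and the radio number $rn(G)$ is the minimum of $\max_{u,v}|f(u)-f(v)|$ over all radio labelings $f$. A block graph is a connected graph whose blocks (maximal connected induced subgraphs without a cut-vertex of their own) are complete. For a finite block graph $G$ of order $p$, let $W(G)$ be the set of weight centers, i.e. the vertices $v$ minimizing $\sum_{u}d(u,v)$; let $\varepsilon(G)=1$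 if $|W(G)|=1$ and $\varepsilon(G)=0$ otherwise. The central vertices of $G$ are the unique weight center if $|W(G)|=1$, and all vertices of the block containing $W(G)$ if $|W(G)|\ge 2$. Let $L(G)$ be the sum over all vertices $v$ of the minimum distance from $v$ to a central vertex. Then $G$ is a lower bound block graph if $$rn(G)=(p-1)\bigl(d(G)+\varepsilon(G)\bigr)-2L(G)+\varepsilon(G).$$ The line graphs $\mathcal L(T^1)$ and $\mathcal L(T^2)$ are lower bound block graphs and, with $n$ denoting the order of the tree ($n=|V(T^1)|$, respectively $n=|V(T^2)|$), $$rn(\mathcal L(T^1))=(d+1)(n-1)+1-2\sum_{i=1}^{h}\Bigl(m_0\cdot i\cdot\prod_{0<j<i}(m_j-1)\Bigr)-2h\quad\text{with } d=2h,$$ $$rn(\mathcal L(T^2))=d(n-1)-4\sum_{i=1}^{h}\Bigl(i\cdot\prod_{j=0}^{i-1}(m_j-1)\Bigr)-2h\quad\text{with } d=2h+1.$$ -/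

import Mathlib

open Finset BigOperators

/-! ### Block graphs -/

namespace SimpleGraph

variable {V : Type*}

/-- A cut-vertex of a finite graph: deleting it increases the number of components. -/
def IsCutVertex [Finite V] (G : SimpleGraph V) (v : V) : Prop :=
  Nat.card G.ConnectedComponent < Nat.card (G.induce ({v}ᶜ : Set V)).ConnectedComponent

/-- A connected graph without cut-vertices. -/
def IsTwoConnected [Finite V] (G : SimpleGraph V) : Prop :=
  G.Connected ∧ ∀ v, ¬ G.IsCutVertex v

/-- `B` is the vertex set of a block: a maximal 2-connected induced subgraph. -/
def IsBlock [Finite V] (G : SimpleGraph V) (B : Set V) : Prop :=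
  Maximal (fun S : Set V => (G.induce S).IsTwoConnected) B

/-- A connected graph all of whose blocks are complete. -/
def IsBlockGraph [Finite V] (G : SimpleGraph V) : Prop :=
  G.Connected ∧ ∀ B, G.IsBlock B → G.IsClique B

/-! ### Weight centers, central vertices, levels -/

/-- The weight of `G` at `v`: the sum of the distances from `v` to all vertices. -/
noncomputable def weightAt [Fintype V] (G : SimpleGraph V) (v : V) : ℕ :=
  ∑ u, G.dist u v

/-- The set `W(G)` of weight centers: the vertices of minimum weight. -/
def weightCenters [Fintype V] (G : SimpleGraph V) : Set V :=
  {v | ∀ u, G.weightAt v ≤ G.weightAt u}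

/-- The central vertices: the weight center if it is unique, and otherwise all the vertices of the
central block, the block that contains every weight center. -/
def centralVertices [Fintype V] (G : SimpleGraph V) : Set V :=
  {w | G.weightCenters = {w} ∨
    (2 ≤ G.weightCenters.ncard ∧ ∃ B, G.IsBlock B ∧ G.weightCenters ⊆ B ∧ w ∈ B)}

/-- The level of `v`: the minimum distance from `v` to a central vertex. -/
noncomputable def level [Fintype V] (G : SimpleGraph V) (v : V) : ℕ :=
  sInf ((fun w => G.dist v w) '' G.centralVertices)

/-- The total level `L(G)`. -/
noncomputable def totalLevel [Fintype V] (G : SimpleGraph V) : ℕ :=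
  ∑ v, G.level v

open Classical in
/-- `ε(G)` is `1` if there is exactly one weight center and `0` otherwise. -/
noncomputable def centerEps [Fintype V] (G : SimpleGraph V) : ℕ :=
  if G.weightCenters.ncard = 1 then 1 else 0

/-! ### Radio labelings -/

/-- A radio labeling: `|f u - f v| ≥ d(G) + 1 - d(u, v)` for all distinct `u`, `v`. -/
def IsRadioLabeling (G : SimpleGraph V) (f : V → ℕ) : Prop :=
  ∀ u v, u ≠ v → (G.diam : ℤ) + 1 - (G.dist u v : ℤ) ≤ |(f u : ℤ) - (f v : ℤ)|

/-- The span of a labeling: the maximum of `|f u - f v|` over all pairs of vertices. -/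
def labelSpan [Fintype V] (f : V → ℕ) : ℕ :=
  (Finset.univ : Finset (V × V)).sup fun p => ((f p.1 : ℤ) - (f p.2 : ℤ)).natAbs

/-- The radio number `rn(G)`: the minimum span of a radio labeling. -/
noncomputable def radioNumber [Fintype V] (G : SimpleGraph V) : ℕ :=
  sInf {s | ∃ f : V → ℕ, G.IsRadioLabeling f ∧ labelSpan f = s}

/-- The number `LB(G) = (p - 1) (d(G) + ε(G)) - 2 L(G) + ε(G)`, where `p` is the order of `G`. -/
noncomputable def radioLB [Fintype V] (G : SimpleGraph V) : ℤ :=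
  ((Fintype.card V : ℤ) - 1) * ((G.diam : ℤ) + G.centerEps) - 2 * G.totalLevel + G.centerEps

/-- A lower bound block graph: a block graph with `rn(G) = LB(G)`. -/
def IsLowerBoundBlockGraph [Fintype V] (G : SimpleGraph V) : Prop :=
  G.IsBlockGraph ∧ (G.radioNumber : ℤ) = G.radioLB

/-! ### Level-wise regular trees -/

/-- `T` is a tree with root `w` and height `h` in which each vertex at distance `i < h` from the
root has degree `m i`. -/
structure IsLevelwiseRegularTreeOne [Fintype V] (T : SimpleGraph V) [DecidableRel T.Adj]
    (w : V) (h : ℕ) (m : ℕ → ℕ) : Prop where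
  isTree : T.IsTree
  dist_le : ∀ v, T.dist w v ≤ h
  height_attained : ∃ v, T.dist w v = h
  degree_eq : ∀ v, T.dist w v < h → T.degree v = m (T.dist w v)

/-- `T` is a tree with two adjacent roots `w`, `w'` and height `h` in which each vertex whose
minimum distance to a root is `i < h` has degree `m i`. -/
structure IsLevelwiseRegularTreeTwo [Fintype V] (T : SimpleGraph V) [DecidableRel T.Adj]
    (w w' : V) (h : ℕ) (m : ℕ → ℕ) : Prop where
  isTree : T.IsTree
  adj : T.Adj w w'
  dist_le : ∀ v, min (T.dist w v) (T.dist w' v) ≤ h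
  height_attained : ∃ v, min (T.dist w v) (T.dist w' v) = h
  degree_eq : ∀ v, min (T.dist w v) (T.dist w' v) < h →
    T.degree v = m (min (T.dist w v) (T.dist w' v))

end SimpleGraph

/-! Both line graphs are handled by one argument. The edges of the tree lie in levels `0, …, H`
around the central clique (edges at the single root, `ε = 0`) or the central edge (joining the two
roots, `ε = 1`). Each edge is numbered within its level so that reducing modulo a chain of moduli `a
0 ∣ a 1 ∣ …` gives the number of its ancestor or of its sibling class; this is `RadialCoordinates`.
The distance then has the closed form `lv x + lv y + 2 - agreement` (`reachable_and_dist`), where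
the agreement counts the moduli under which the two numbers coincide.

From this formula the diameter is `2 * H + 1 - ε`, the weight centers are exactly the vertices of
level `0`, and the level of a vertex is `lv`. The radio condition becomes: labels of `x` and `y`
differ by at least `(H - lv x) + (H - lv y) + agreement - ε`.

Lower bound (`exists_span_ge`): the agreement is at least `ε + 1`, so consecutive labels differ by
at least `2 * H + 1` minus the two levels. Summing counts each level twice except at the two ends,
where the levels add up to at least `ε`.

Upper bound (`exists_labeling`): list the vertices level by level in order of number, move the first
one to the end, and take every consecutive gap as small as that bound permits. Vertices agreeing
modulo `a j` have positions congruent modulo `a j`, hence at least `a j ≥ j + 1 - ε` apart, which is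
just enough for non-consecutive pairs (`agreement_le_position_sub`). The condition `m i ≥ 3` makes
the layers, and so the moduli, grow fast enough. -/

namespace SimpleGraph

variable {X : Type*}

/-! ### Distances in radial coordinates -/

/-- A function satisfying the local rules of the distance to a fixed vertex is that distance. -/
theorem reachable_and_dist_eq_of_local {G : SimpleGraph X} {D : X → ℕ} {y : X} (h0 : D y = 0)
    (hlip : ∀ x z, G.Adj x z → D x ≤ D z + 1)
    (hdesc : ∀ x, x ≠ y → ∃ z, G.Adj x z ∧ D z + 1 ≤ D x) (x : X) :
    G.Reachable x y ∧ G.dist x y = D x := by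
  have lower : ∀ x (p : G.Walk x y), D x ≤ p.length := by
    intro x p
    induction p with
    | nil => simp [h0]
    | cons hadj p ih =>
      have := hlip _ _ hadj
      have := ih h0 hdesc
      simp only [Walk.length_cons]
      omega
  have upper : ∀ n x, D x ≤ n → ∃ p : G.Walk x y, p.length ≤ D x := by
    intro n
    induction n with
    | zero =>
      intro x hx
      by_cases hxy : x = y
      · subst hxy; exact ⟨Walk.nil, by simp⟩
      · obtain ⟨z, -, hz⟩ := hdesc x hxy; omega
    | succ n ih =>
      intro x hx
      by_cases hxy : x = y
      · subst hxy; exact ⟨Walk.nil, by simp⟩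
      · obtain ⟨z, hadj, hz⟩ := hdesc x hxy
        obtain ⟨p, hp⟩ := ih z (by omega)
        exact ⟨Walk.cons hadj p, by simp only [Walk.length_cons]; omega⟩
  obtain ⟨p, hp⟩ := upper _ x le_rfl
  refine ⟨p.reachable, le_antisymm ((dist_le p).trans hp) ?_⟩
  obtain ⟨q, hq⟩ := p.reachable.exists_walk_length_eq_dist
  exact hq ▸ lower x q

/-- Coordinates of a vertex set arranged in levels `0, …, H`: level `c` has `a (2 * c + 1)`
vertices, numbered so that the parent of a vertex of level `c + 1` is obtained by reducing its
number modulo `a (2 * c + 1)`; two vertices of level `c` are adjacent when their numbers agree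
modulo `a (2 * c)`. -/
structure RadialCoordinates (G : SimpleGraph X) (H ε : ℕ) (a : ℕ → ℕ) (lv ix : X → ℕ) :
    Prop where
  a_zero : a 0 = 1
  dvd_succ : ∀ j, a j ∣ a (j + 1)
  le_a : ∀ j, j ≤ 2 * H + 1 → j + 1 ≤ a j + ε
  center : (ε = 0 ∧ 3 ≤ a 1) ∨ (ε = 1 ∧ a 1 = 1 ∧ a 2 = 2 ∧ 1 ≤ H)
  lv_le : ∀ x, lv x ≤ H
  ix_lt : ∀ x, ix x < a (2 * lv x + 1)
  inj : ∀ x y, lv x = lv y → ix x = ix y → x = y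
  surj : ∀ c, c ≤ H → ∀ k, k < a (2 * c + 1) → ∃ x, lv x = c ∧ ix x = k
  adj_iff : ∀ x y, G.Adj x y ↔ x ≠ y ∧
    ((lv x = lv y ∧ ix x ≡ ix y [MOD a (2 * lv x)]) ∨
      (lv y = lv x + 1 ∧ ix x ≡ ix y [MOD a (2 * lv x + 1)]) ∨
      (lv x = lv y + 1 ∧ ix x ≡ ix y [MOD a (2 * lv y + 1)]))

/-- The number of moduli, up to the lower of the two levels, for which two vertices agree. -/
def agreement (a : ℕ → ℕ) (lv ix : X → ℕ) (x y : X) : ℕ :=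
  #{j ∈ range (2 * min (lv x) (lv y) + 2) | ix x ≡ ix y [MOD a j]}

namespace RadialCoordinates

variable {G : SimpleGraph X} {H ε : ℕ} {a : ℕ → ℕ} {lv ix : X → ℕ}

theorem dvd_of_le (hc : RadialCoordinates G H ε a lv ix) {i j : ℕ} (hij : i ≤ j) : a i ∣ a j := by
  induction j, hij using Nat.le_induction with
  | base => exact dvd_rfl
  | succ j _ ih => exact ih.trans (hc.dvd_succ j)

theorem modEq_of_le (hc : RadialCoordinates G H ε a lv ix) {i j u v : ℕ} (hij : i ≤ j)
    (h : u ≡ v [MOD a j]) : u ≡ v [MOD a i] :=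
  h.of_dvd (hc.dvd_of_le hij)

theorem modEq_zero (hc : RadialCoordinates G H ε a lv ix) (u v : ℕ) : u ≡ v [MOD a 0] := by
  rw [hc.a_zero]; exact Nat.modEq_one

theorem eps_le (hc : RadialCoordinates G H ε a lv ix) : ε ≤ 1 := by
  rcases hc.center with h | h <;> omega

theorem a_pos (hc : RadialCoordinates G H ε a lv ix) {j : ℕ} (hj : j ≤ 2 * H + 1) : 0 < a j := by
  have := hc.le_a j hj
  have := hc.eps_le
  rcases Nat.eq_zero_or_pos j with rfl | h
  · rw [hc.a_zero]; exact one_pos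
  · omega

/-- The moduli divide one another, so the congruences are nested and the counted indices form an
initial segment. -/
theorem lt_agreement_iff (hc : RadialCoordinates G H ε a lv ix) {x y : X} {j : ℕ} :
    j < agreement a lv ix x y ↔
      j < 2 * min (lv x) (lv y) + 2 ∧ ix x ≡ ix y [MOD a j] := by
  set S := {j ∈ range (2 * min (lv x) (lv y) + 2) | ix x ≡ ix y [MOD a j]} with hS
  have mem : ∀ j, j ∈ S ↔ j < 2 * min (lv x) (lv y) + 2 ∧ ix x ≡ ix y [MOD a j] := by
    simp [hS]
  have down : ∀ i j, i ≤ j → j ∈ S → i ∈ S := by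
    intro i j hij hj
    rw [mem] at hj ⊢
    exact ⟨by omega, hc.modEq_of_le hij hj.2⟩
  change j < #S ↔ _
  rw [← mem]
  constructor
  · intro hj
    by_contra hn
    have : S ⊆ range j := by
      intro i hi
      rw [Finset.mem_range]
      by_contra hij
      exact hn (down j i (by omega) hi)
    have := card_le_card this
    rw [card_range] at this
    omega
  · intro hj
    have : range (j + 1) ⊆ S := fun i hi => down i j (by rw [Finset.mem_range] at hi; omega) hj
    have := card_le_card this
    rw [card_range] at this
    omega

theorem agreement_le (hc : RadialCoordinates G H ε a lv ix) (x y : X) :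
    agreement a lv ix x y ≤ 2 * min (lv x) (lv y) + 2 := by
  by_contra h
  have := (hc.lt_agreement_iff (x := x) (y := y)).1 (not_le.1 h)
  omega

theorem le_agreement (hc : RadialCoordinates G H ε a lv ix) {x y : X} {j : ℕ}
    (hj : j ≤ 2 * min (lv x) (lv y) + 1) (h : ix x ≡ ix y [MOD a j]) :
    j + 1 ≤ agreement a lv ix x y :=
  hc.lt_agreement_iff.2 ⟨by omega, h⟩

theorem agreement_pos (hc : RadialCoordinates G H ε a lv ix) (x y : X) :
    1 ≤ agreement a lv ix x y :=
  hc.le_agreement (j := 0) (by omega) (hc.modEq_zero _ _)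

/-- With a single central vertex both `a 0` and `a 1` are `1`, so two congruences come for free
instead of one. -/
theorem eps_lt_agreement (hc : RadialCoordinates G H ε a lv ix) (x y : X) :
    ε + 1 ≤ agreement a lv ix x y := by
  refine hc.le_agreement (by have := hc.eps_le; omega) ?_
  rcases hc.center with ⟨rfl, -⟩ | ⟨rfl, h, -⟩
  · exact hc.modEq_zero _ _
  · rw [h]; exact Nat.modEq_one

theorem agreement_comm (a : ℕ → ℕ) (lv ix : X → ℕ) (x y : X) :
    agreement a lv ix x y = agreement a lv ix y x := by
  unfold agreement
  rw [min_comm]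
  congr 1
  ext j
  simp only [mem_filter]
  exact and_congr_right fun _ => ⟨Nat.ModEq.symm, Nat.ModEq.symm⟩

theorem agreement_self (a : ℕ → ℕ) (lv ix : X → ℕ) (x : X) :
    agreement a lv ix x x = 2 * lv x + 2 := by
  simp [agreement, Nat.ModEq.refl]

/-- The vertex of level `c` whose number is `k` modulo the size of the level. -/
theorem exists_vertex (hc : RadialCoordinates G H ε a lv ix) {c : ℕ} (hcH : c ≤ H) (k : ℕ) :
    ∃ x, lv x = c ∧ ix x ≡ k [MOD a (2 * c + 1)] := by
  obtain ⟨x, hx, hk⟩ := hc.surj c hcH (k % a (2 * c + 1))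
    (Nat.mod_lt _ (hc.a_pos (by omega)))
  exact ⟨x, hx, hk ▸ Nat.mod_modEq _ _⟩

theorem eq_of_modEq (hc : RadialCoordinates G H ε a lv ix) {x y : X} (hl : lv x = lv y)
    (h : ix x ≡ ix y [MOD a (2 * lv x + 1)]) : x = y := by
  refine hc.inj x y hl ?_
  have hy := hc.ix_lt y
  rw [← hl] at hy
  exact h.eq_of_lt_of_lt (hc.ix_lt x) hy

/-- Moving from `x` to `z` gains at most 1 agreement sideways, 2 outwards and 0 inwards. Since the
agreement of `z` is at most `2 * lv z + 2`, lowering it by 2, 3 or 1 before taking it as an index of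
a modulus lands in the range where `x` and `z` are congruent. -/
theorem agreement_step (hc : RadialCoordinates G H ε a lv ix) {x z : X} (hadj : G.Adj x z)
    (y : X) :
    lv x + agreement a lv ix z y ≤ lv z + agreement a lv ix x y + 1 := by
  have key : ∀ j, j < agreement a lv ix z y →
      ix x ≡ ix z [MOD a j] → j ≤ 2 * lv x + 1 → j + 1 ≤ agreement a lv ix x y := by
    intro j hj hxz hjx
    rw [hc.lt_agreement_iff] at hj
    exact hc.le_agreement (by omega) (hxz.trans hj.2)
  have hle := hc.agreement_le z y
  rcases ((hc.adj_iff x z).1 hadj).2 with ⟨h, hm⟩ | ⟨h, hm⟩ | ⟨h, hm⟩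
  · by_contra hcon
    have := key (agreement a lv ix z y - 2) (by omega)
      (hc.modEq_of_le (by omega) hm) (by omega)
    omega
  · by_contra hcon
    have := key (agreement a lv ix z y - 3) (by omega)
      (hc.modEq_of_le (by omega) hm) (by omega)
    omega
  · by_contra hcon
    have := key (agreement a lv ix z y - 1) (by omega)
      (hc.modEq_of_le (by omega) hm) (by omega)
    omega

/-- Three moves, according to how far `x` and `y` agree: inwards if `x` is not even in the sibling
class leading to `y`, sideways if it is in that class but is not on the branch itself, and outwards
along the branch if `x` is an ancestor of `y`. -/
theorem exists_adj_closer (hc : RadialCoordinates G H ε a lv ix) {x y : X} (hxy : x ≠ y) :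
    ∃ z, G.Adj x z ∧ lv z + agreement a lv ix x y + 1 ≤ lv x + agreement a lv ix z y := by
  have hle := hc.agreement_le x y
  have hpos := hc.agreement_pos x y
  have hyH := hc.lv_le y
  have hxH := hc.lv_le x
  rcases lt_trichotomy (agreement a lv ix x y) (2 * lv x + 1) with h | h | h
  · obtain ⟨z, hz, hzx⟩ := hc.exists_vertex (c := lv x - 1) (by omega) (ix x)
    refine ⟨z, (hc.adj_iff x z).2 ⟨by rintro rfl; omega, Or.inr (Or.inr ⟨by omega, ?_⟩)⟩, ?_⟩
    · rw [hz]; exact hzx.symm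
    · have hj := (hc.lt_agreement_iff (x := x) (y := y)
        (j := agreement a lv ix x y - 1)).1 (by omega)
      have := hc.le_agreement (x := z) (y := y) (j := agreement a lv ix x y - 1) (by omega)
        ((hc.modEq_of_le (by omega) hzx).trans hj.2)
      omega
  · have hj := (hc.lt_agreement_iff (x := x) (y := y) (j := 2 * lv x)).1 (by omega)
    obtain ⟨z, hz, hzy⟩ := hc.exists_vertex hxH (ix y)
    have hA : 2 * lv x + 1 + 1 ≤ agreement a lv ix z y := hc.le_agreement (by omega) hzy
    refine ⟨z, (hc.adj_iff x z).2 ⟨?_, Or.inl ⟨hz.symm, ?_⟩⟩, by omega⟩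
    · rintro rfl; omega
    · exact hj.2.trans (hc.modEq_of_le (by omega) hzy.symm)
  · have hj := (hc.lt_agreement_iff (x := x) (y := y) (j := 2 * lv x + 1)).1 (by omega)
    have hlt : lv x < lv y := by
      rcases lt_or_eq_of_le (show lv x ≤ lv y by omega) with h' | h'
      · exact h'
      · exact absurd (hc.eq_of_modEq h' hj.2) hxy
    obtain ⟨z, hz, hzy⟩ := hc.exists_vertex (c := lv x + 1) (by omega) (ix y)
    refine ⟨z, (hc.adj_iff x z).2 ⟨by rintro rfl; omega, Or.inr (Or.inl ⟨hz, ?_⟩)⟩, ?_⟩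
    · exact hj.2.trans (hc.modEq_of_le (by omega) hzy.symm)
    · have := hc.le_agreement (x := z) (y := y) (by omega) hzy
      omega

theorem reachable_and_dist (hc : RadialCoordinates G H ε a lv ix) (x y : X) :
    G.Reachable x y ∧ G.dist x y = lv x + lv y + 2 - agreement a lv ix x y := by
  refine reachable_and_dist_eq_of_local
    (D := fun x => lv x + lv y + 2 - agreement a lv ix x y) ?_ ?_ ?_ x
  · simp only [agreement_self]; omega
  · intro x z hadj
    have := hc.agreement_step hadj y
    have := hc.agreement_le x y
    have := hc.agreement_le z y
    omega
  · intro x hxy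
    obtain ⟨z, hadj, hz⟩ := hc.exists_adj_closer hxy
    have := hc.agreement_le x y
    have := hc.agreement_le z y
    refine ⟨z, hadj, ?_⟩
    omega

theorem dist_add_agreement (hc : RadialCoordinates G H ε a lv ix) (x y : X) :
    G.dist x y + agreement a lv ix x y = lv x + lv y + 2 := by
  have := (hc.reachable_and_dist x y).2
  have := hc.agreement_le x y
  omega

theorem nonempty (hc : RadialCoordinates G H ε a lv ix) : Nonempty X :=
  let ⟨x, _⟩ := hc.exists_vertex (Nat.zero_le H) 0
  ⟨x⟩

theorem connected (hc : RadialCoordinates G H ε a lv ix) : G.Connected :=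
  have := hc.nonempty
  ⟨fun x y => (hc.reachable_and_dist x y).1⟩

end RadialCoordinates

end SimpleGraph

/-! ### Blocks are cliques -/

namespace SimpleGraph

variable {X : Type*}

theorem Connected.exists_adj_adj_not_adj {G : SimpleGraph X} (hG : G.Connected) {x y : X}
    (hne : x ≠ y) (hadj : ¬ G.Adj x y) :
    ∃ u g v, G.Adj u g ∧ G.Adj g v ∧ u ≠ v ∧ ¬ G.Adj u v := by
  obtain ⟨p, hp⟩ := hG.exists_walk_length_eq_dist x y
  have h := hG.one_lt_dist_of_ne_of_not_adj hne hadj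
  obtain ⟨u, g, v, h1, h2, h3, h4⟩ := p.exists_adj_adj_not_adj_ne hp h
  exact ⟨u, g, v, h1, h2, h4, h3⟩

/-- A vertex `g` with two neighbours in different components of `G - g` is a cut-vertex. -/
theorem Connected.isCutVertex_of_separation [Finite X] {G : SimpleGraph X} (hG : G.Connected)
    {g u v : X} (C : Set X) (hu : u ≠ g) (hv : v ≠ g) (huC : u ∈ C) (hvC : v ∉ C)
    (hC : ∀ x y, x ∈ C → G.Adj x y → y ≠ g → y ∈ C) : G.IsCutVertex g := by
  have h1 : Nat.card G.ConnectedComponent = 1 := by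
    have := hG.preconnected.subsingleton_connectedComponent
    have : Nonempty G.ConnectedComponent := ⟨G.connectedComponentMk u⟩
    exact Nat.card_of_subsingleton (G.connectedComponentMk u)
  have hnr : ¬ (G.induce ({g}ᶜ : Set X)).Reachable ⟨u, hu⟩ ⟨v, hv⟩ := by
    rintro ⟨p⟩
    have key : ∀ x y (_ : (G.induce ({g}ᶜ : Set X)).Walk x y), x.1 ∈ C → y.1 ∈ C := by
      intro x y q
      induction q with
      | nil => exact id
      | @cons _ z _ hadj _ ih => exact fun hx => ih (hC _ _ hx hadj z.2)
    exact hvC (key _ _ p huC)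
  rw [IsCutVertex, h1, Finite.one_lt_card_iff_nontrivial]
  exact ⟨⟨_, _, fun h => hnr (ConnectedComponent.exact h)⟩⟩

/-- A nonempty clique is 2-connected. -/
theorem IsClique.isTwoConnected [Finite X] {G : SimpleGraph X} {S : Set X} (hS : G.IsClique S)
    (hne : S.Nonempty) : (G.induce S).IsTwoConnected := by
  have := hne.to_subtype
  have hadj : ∀ x y : S, x ≠ y → (G.induce S).Adj x y := fun x y hxy =>
    hS x.2 y.2 (fun h => hxy (Subtype.ext h))
  have hconn : (G.induce S).Connected := ⟨fun x y => by
    by_cases h : x = y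
    · exact h ▸ Reachable.rfl
    · exact (hadj x y h).reachable⟩
  refine ⟨hconn, fun v => not_lt.2 ?_⟩
  have hpre : ((G.induce S).induce ({v}ᶜ : Set S)).Preconnected := fun x y => by
    by_cases h : x = y
    · exact h ▸ Reachable.rfl
    · exact Adj.reachable (hadj x.1 y.1 (fun h' => h (Subtype.ext h')))
  have := hpre.subsingleton_connectedComponent
  have : Nonempty (G.induce S).ConnectedComponent :=
    hne.to_subtype.map (G.induce S).connectedComponentMk
  exact Finite.card_le_one_iff_subsingleton.2 ‹_› |>.trans Nat.card_pos

namespace RadialCoordinates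

variable {G : SimpleGraph X} {H ε : ℕ} {a : ℕ → ℕ} {lv ix : X → ℕ}

/-- A child `u` of `g` and a neighbour `v` of `g` not adjacent to `u` are separated by `g`. -/
theorem exists_separation (hc : RadialCoordinates G H ε a lv ix) {u g v : X}
    (hlv : lv u = lv g + 1) (hug : G.Adj u g) (hgv : G.Adj g v) (huv : u ≠ v)
    (hadj : ¬ G.Adj u v) :
    ∃ C : Set X, u ∈ C ∧ v ∉ C ∧ ∀ x y, x ∈ C → G.Adj x y → y ≠ g → y ∈ C := by
  have hugm : ix u ≡ ix g [MOD a (2 * lv g + 1)] := by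
    rcases ((hc.adj_iff u g).1 hug).2 with h | h | h
    · omega
    · omega
    · exact h.2
  -- The sibling class of `u` below `g` together with all its descendants: the only exit is through
  -- `g`.
  refine ⟨{z | lv g + 1 ≤ lv z ∧ ix z ≡ ix u [MOD a (2 * lv g + 2)]},
    ⟨hlv.ge, Nat.ModEq.rfl⟩, ?_, ?_⟩
  · rintro ⟨hv1, hv2⟩
    refine hadj ((hc.adj_iff u v).2 ⟨huv, Or.inl ⟨?_, ?_⟩⟩)
    · rcases ((hc.adj_iff g v).1 hgv).2 with h | h | h <;> omega
    · rw [hlv]; exact hv2.symm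
  · rintro x y ⟨hx1, hx2⟩ hxy hyg
    rcases ((hc.adj_iff x y).1 hxy).2 with ⟨h, hm⟩ | ⟨h, hm⟩ | ⟨h, hm⟩
    · exact ⟨by omega, (hc.modEq_of_le (by omega) hm.symm).trans hx2⟩
    · exact ⟨by omega, (hc.modEq_of_le (by omega) hm.symm).trans hx2⟩
    · rcases Nat.lt_or_ge (lv g) (lv y) with h' | h'
      · exact ⟨h', (hc.modEq_of_le (by omega) hm.symm).trans hx2⟩
      · have hgy : lv y = lv g := by omega
        refine absurd (hc.eq_of_modEq hgy ?_) hyg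
        rw [hgy] at hm ⊢
        exact hm.symm.trans ((hc.modEq_of_le (by omega) hx2).trans hugm)

/-- If `S` is not a clique, some `u, v` in it are non-adjacent with a common neighbour `g` in `S`.
When one of them is a child of `g`, the vertex `g` separates them, so it is a cut-vertex. -/
theorem isClique_of_isTwoConnected [Finite X] (hc : RadialCoordinates G H ε a lv ix) {S : Set X}
    (hS : (G.induce S).IsTwoConnected) : G.IsClique S := by
  by_contra hcl
  obtain ⟨x, hx, y, hy, hne, hxy⟩ : ∃ x ∈ S, ∃ y ∈ S, x ≠ y ∧ ¬ G.Adj x y := by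
    simpa [IsClique, Set.Pairwise] using hcl
  obtain ⟨u, g, v, hug, hgv, huv, hadj⟩ := hS.1.exists_adj_adj_not_adj
    (x := ⟨x, hx⟩) (y := ⟨y, hy⟩) (fun h => hne (congrArg Subtype.val h)) hxy
  have hug' : G.Adj u.1 g.1 := hug
  have hgv' : G.Adj g.1 v.1 := hgv
  have hadj' : ¬ G.Adj u.1 v.1 := hadj
  have huv' : u.1 ≠ v.1 := fun h => huv (Subtype.ext h)
  have finish : ∀ C : Set X, (u.1 ∈ C ∧ v.1 ∉ C ∨ v.1 ∈ C ∧ u.1 ∉ C) →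
      (∀ x y, x ∈ C → G.Adj x y → y ≠ g.1 → y ∈ C) → False := by
    intro C hC hcl
    have hcl' : ∀ x y : S, x ∈ Subtype.val ⁻¹' C → (G.induce S).Adj x y → y ≠ g →
        y ∈ Subtype.val ⁻¹' C :=
      fun x y hx hxy hy => hcl x y hx hxy (fun h => hy (Subtype.ext h))
    rcases hC with ⟨h1, h2⟩ | ⟨h1, h2⟩
    · exact hS.2 g (hS.1.isCutVertex_of_separation (Subtype.val ⁻¹' C) hug.ne hgv.ne' h1 h2 hcl')
    · exact hS.2 g (hS.1.isCutVertex_of_separation (Subtype.val ⁻¹' C) hgv.ne' hug.ne h1 h2 hcl')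
  by_cases h1 : lv u.1 = lv g.1 + 1
  · obtain ⟨C, hC⟩ := hc.exists_separation h1 hug' hgv' huv' hadj'
    exact finish C (Or.inl ⟨hC.1, hC.2.1⟩) hC.2.2
  by_cases h2 : lv v.1 = lv g.1 + 1
  · obtain ⟨C, hC⟩ := hc.exists_separation h2 hgv'.symm hug'.symm huv'.symm
      (fun h => hadj' h.symm)
    exact finish C (Or.inr ⟨hC.1, hC.2.1⟩) hC.2.2
  -- Neither is a child of `g`, so each is its parent or a sibling; any two such vertices are equal
  -- or adjacent.
  refine hadj' ((hc.adj_iff _ _).2 ⟨huv', ?_⟩)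
  rcases ((hc.adj_iff _ _).1 hug').2 with ⟨h, hm⟩ | ⟨h, hm⟩ | ⟨h, hm⟩
  · rcases ((hc.adj_iff _ _).1 hgv').2 with ⟨h', hm'⟩ | ⟨h', hm'⟩ | ⟨h', hm'⟩
    · exact Or.inl ⟨h.trans h', hm.trans (h ▸ hm')⟩
    · omega
    · exact Or.inr (Or.inr ⟨h.trans h', (hc.modEq_of_le (by omega) hm).trans hm'⟩)
  · rcases ((hc.adj_iff _ _).1 hgv').2 with ⟨h', hm'⟩ | ⟨h', hm'⟩ | ⟨h', hm'⟩
    · exact Or.inr (Or.inl ⟨by omega, hm.trans (hc.modEq_of_le (by omega) hm')⟩)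
    · omega
    · have hl : lv u.1 = lv v.1 := by omega
      refine absurd (hc.eq_of_modEq hl (hm.trans ?_)) huv'
      rw [hl]; exact hm'
  · omega

theorem isBlockGraph [Finite X] (hc : RadialCoordinates G H ε a lv ix) : G.IsBlockGraph :=
  ⟨hc.connected, fun _ hB => hc.isClique_of_isTwoConnected hB.1⟩

/-! ### Diameter, weight centers and levels -/

theorem agreement_le_two (hc : RadialCoordinates G H ε a lv ix) {x y : X}
    (hy : lv y = 0) : agreement a lv ix x y ≤ 2 := by
  have := hc.agreement_le x y
  omega

theorem two_le_a (hc : RadialCoordinates G H ε a lv ix) : 2 ≤ a (ε + 1) := by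
  rcases hc.center with ⟨rfl, h⟩ | ⟨rfl, h1, h2, h3⟩
  · exact (by omega : 2 ≤ 3).trans h
  · exact h2.ge

theorem ediam_ne_top [Finite X] (hc : RadialCoordinates G H ε a lv ix) : G.ediam ≠ ⊤ := by
  have := hc.nonempty
  exact connected_iff_ediam_ne_top.1 hc.connected

theorem diam_add_eps [Finite X] (hc : RadialCoordinates G H ε a lv ix) :
    G.diam + ε = 2 * H + 1 := by
  have := hc.nonempty
  apply le_antisymm
  · obtain ⟨x, y, hxy⟩ := G.exists_dist_eq_diam
    have := hc.dist_add_agreement x y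
    have := hc.eps_lt_agreement x y
    have := hc.lv_le x
    have := hc.lv_le y
    omega
  · have he := hc.eps_le
    have hH : ε + 1 ≤ 2 * H + 1 := by
      rcases hc.center with h | h <;> omega
    have h2 := (Nat.le_of_dvd (hc.a_pos le_rfl) (hc.dvd_of_le hH)).trans' hc.two_le_a
    -- Numbers `0` and `1` on the last level already differ modulo `a (ε + 1) ≥ 2`, so the agreement
    -- takes its least value `ε + 1`.
    obtain ⟨x, hx, hx'⟩ := hc.surj H le_rfl 0 (by omega)
    obtain ⟨y, hy, hy'⟩ := hc.surj H le_rfl 1 (by omega)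
    have := hc.dist_add_agreement x y
    have := G.dist_le_diam hc.ediam_ne_top (u := x) (v := y)
    have : agreement a lv ix x y ≤ ε + 1 := by
      by_contra h
      have h := (hc.lt_agreement_iff (x := x) (y := y)).1 (not_le.1 h)
      rw [hx', hy'] at h
      have := (Nat.modEq_iff_dvd' (by omega)).1 h.2
      have := hc.two_le_a
      have := Nat.le_of_dvd (by omega) ‹a (ε + 1) ∣ 1 - 0›
      omega
    omega

theorem exists_lv_eq_zero (hc : RadialCoordinates G H ε a lv ix) : ∃ x, lv x = 0 :=
  let ⟨x, hx, _⟩ := hc.exists_vertex (Nat.zero_le H) 0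
  ⟨x, hx⟩

/-- A vertex of positive level is adjacent to at most one vertex of level `0`, as `a 1` separates
the numbers of that level. The central clique therefore cannot be enlarged. -/
theorem lv_eq_zero_of_isClique (hc : RadialCoordinates G H ε a lv ix) (h1 : 2 ≤ a 1) {S : Set X}
    (hS : G.IsClique S) (hsub : {x | lv x = 0} ⊆ S) {x : X} (hx : x ∈ S) : lv x = 0 := by
  by_contra hne
  obtain ⟨u, hu, hu'⟩ := hc.surj 0 (Nat.zero_le H) 0 (by simp only [mul_zero, zero_add]; omega)
  obtain ⟨v, hv, hv'⟩ := hc.surj 0 (Nat.zero_le H) 1 (by simp only [mul_zero, zero_add]; omega)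
  have key : ∀ z, lv z = 0 → ix x ≡ ix z [MOD a 1] := by
    intro z hz
    have hadj := hS hx (hsub hz) (by rintro rfl; exact hne hz)
    rcases ((hc.adj_iff x z).1 hadj).2 with h | h | h
    · omega
    · omega
    · simpa [hz] using h.2
  have huv := hc.eq_of_modEq (hu.trans hv.symm) (by
    simpa [hu] using (key u hu).symm.trans (key v hv))
  rw [huv] at hu'
  omega

section Fintype

variable [Fintype X]

/-- Sums over the vertices, taken level by level. -/
theorem sum_eq (hc : RadialCoordinates G H ε a lv ix) (F : ℕ → ℕ → ℕ) :
    ∑ x, F (lv x) (ix x) = ∑ c ∈ range (H + 1), ∑ k ∈ range (a (2 * c + 1)), F c k := by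
  rw [Finset.sum_sigma']
  refine Finset.sum_bij (fun x _ => (⟨lv x, ix x⟩ : Σ _ : ℕ, ℕ)) ?_ ?_ ?_ ?_
  · intro x _
    have := hc.lv_le x
    have := hc.ix_lt x
    simp only [mem_sigma, Finset.mem_range]
    omega
  · intro x _ y _ h
    simp only [Sigma.mk.injEq, heq_eq_eq] at h
    exact hc.inj x y h.1 h.2
  · rintro ⟨c, k⟩ h
    simp only [mem_sigma, Finset.mem_range] at h
    obtain ⟨x, hx, hk⟩ := hc.surj c (by omega) k h.2
    exact ⟨x, mem_univ _, by simp [hx, hk]⟩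
  · intros; rfl

theorem card_eq (hc : RadialCoordinates G H ε a lv ix) :
    Fintype.card X = ∑ c ∈ range (H + 1), a (2 * c + 1) := by
  have := hc.sum_eq (fun _ _ => 1)
  simpa using this

theorem sum_lv (hc : RadialCoordinates G H ε a lv ix) :
    ∑ x, lv x = ∑ c ∈ range (H + 1), c * a (2 * c + 1) := by
  have := hc.sum_eq (fun c _ => c)
  simpa [mul_comm] using this

/-- The number of vertices of level at least `j / 2`, divided by `a j`. -/
def classSize (a : ℕ → ℕ) (H j : ℕ) : ℕ :=
  ∑ c ∈ range (H + 1), if j / 2 ≤ c then a (2 * c + 1) / a j else 0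

theorem card_class (hc : RadialCoordinates G H ε a lv ix) (x : X) {j : ℕ} (hj : j ≤ 2 * H + 1) :
    (∑ y, if j / 2 ≤ lv y ∧ ix y ≡ ix x [MOD a j] then 1 else 0) = classSize a H j := by
  rw [hc.sum_eq (fun c k => if j / 2 ≤ c ∧ k ≡ ix x [MOD a j] then 1 else 0), classSize]
  refine sum_congr rfl fun c _ => ?_
  split_ifs with h
  · simp only [h, true_and]
    rw [← card_filter, ← Nat.count_eq_card_filter_range, Nat.count_modEq_card _ (hc.a_pos hj),
      Nat.mod_eq_zero_of_dvd (hc.dvd_of_le (by omega))]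
    simp
  · simp [h]

theorem classSize_mul (hc : RadialCoordinates G H ε a lv ix) (j : ℕ) :
    classSize a H j * a j ≤ Fintype.card X := by
  rw [hc.card_eq, classSize, sum_mul]
  refine sum_le_sum fun c _ => ?_
  split_ifs
  · exact Nat.div_mul_le_self _ _
  · simp

/-- Double counting: for each modulus, the number of vertices agreeing with `x` depends only on the
modulus. Hence the weight of a vertex depends only on its level. -/
theorem sum_agreement (hc : RadialCoordinates G H ε a lv ix) (x : X) :
    ∑ y, agreement a lv ix y x = ∑ j ∈ range (2 * lv x + 2), classSize a H j := by
  have : ∀ y, agreement a lv ix y x = ∑ j ∈ range (2 * lv x + 2),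
      if j / 2 ≤ lv y ∧ ix y ≡ ix x [MOD a j] then 1 else 0 := by
    intro y
    rw [← card_filter, agreement]
    congr 1
    ext j
    simp only [mem_filter, Finset.mem_range, ← and_assoc]
    exact and_congr_left fun _ => by omega
  simp only [this]
  rw [sum_comm]
  refine sum_congr rfl fun j hj => hc.card_class x ?_
  have := hc.lv_le x
  rw [Finset.mem_range] at hj
  omega

theorem weightAt_add (hc : RadialCoordinates G H ε a lv ix) (x : X) :
    G.weightAt x + ∑ j ∈ range (2 * lv x + 2), classSize a H j
      = ∑ y, lv y + Fintype.card X * (lv x + 2) := by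
  rw [weightAt, ← hc.sum_agreement, ← sum_add_distrib]
  simp only [hc.dist_add_agreement, add_assoc]
  rw [sum_add_distrib]
  simp

theorem card_pos (hc : RadialCoordinates G H ε a lv ix) : 0 < Fintype.card X :=
  have := hc.nonempty
  Fintype.card_pos

/-- The two moduli are at least 2 and 3, and `1/2 + 1/3 < 1`. One step outwards adds the order of
the graph to the weight and removes only these two class sizes, so weight strictly increases with
level. -/
theorem classSize_lt (hc : RadialCoordinates G H ε a lv ix) {c : ℕ} (hcH : c + 1 ≤ H) :
    classSize a H (2 * c + 2) + classSize a H (2 * c + 3) < Fintype.card X := by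
  have h2 := hc.classSize_mul (2 * c + 2)
  have h3 := hc.classSize_mul (2 * c + 3)
  have l2 := hc.le_a (2 * c + 2) (by omega)
  have l3 := hc.le_a (2 * c + 3) (by omega)
  have he := hc.eps_le
  have hp := hc.card_pos
  have h2' := (Nat.mul_le_mul_left (classSize a H (2 * c + 2)) (show 2 ≤ _ by omega)).trans h2
  have h3' := (Nat.mul_le_mul_left (classSize a H (2 * c + 3)) (show 3 ≤ _ by omega)).trans h3
  omega

theorem weight_lt (hc : RadialCoordinates G H ε a lv ix) {c : ℕ} (hcH : c + 1 ≤ H) :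
    Fintype.card X * (0 + 2) + ∑ j ∈ range (2 * (c + 1) + 2), classSize a H j <
      Fintype.card X * (c + 1 + 2) + ∑ j ∈ range (2 * 0 + 2), classSize a H j := by
  induction c with
  | zero =>
    have := hc.classSize_lt hcH
    simp only [sum_range_succ, sum_range_zero] at this ⊢
    simp only [mul_zero, zero_add] at this
    linarith
  | succ c ih =>
    have := hc.classSize_lt hcH
    have := ih (by omega)
    rw [show 2 * (c + 1 + 1) + 2 = 2 * (c + 1) + 2 + 1 + 1 by ring, sum_range_succ,
      sum_range_succ]
    linarith

theorem weightCenters_eq (hc : RadialCoordinates G H ε a lv ix) :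
    G.weightCenters = {x | lv x = 0} := by
  have eqw : ∀ x y, lv x = lv y → G.weightAt x = G.weightAt y := by
    intro x y h
    have h1 := hc.weightAt_add x
    have h2 := hc.weightAt_add y
    rw [h] at h1
    omega
  have ltw : ∀ x y, lv x = 0 → lv y ≠ 0 → G.weightAt x < G.weightAt y := by
    intro x y hx hy
    obtain ⟨c, hcy⟩ := Nat.exists_eq_succ_of_ne_zero hy
    have h1 := hc.weightAt_add x
    have h2 := hc.weightAt_add y
    have h3 := hc.weight_lt (c := c) (by have := hc.lv_le y; omega)
    rw [hx] at h1
    rw [hcy] at h2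
    simp only [Nat.succ_eq_add_one] at h2
    linarith
  ext x
  simp only [weightCenters, Set.mem_ofPred_eq]
  constructor
  · intro h
    by_contra hx
    obtain ⟨z, hz⟩ := hc.exists_lv_eq_zero
    exact absurd (h z) (not_le.2 (ltw z x hz hx))
  · intro hx u
    by_cases hu : lv u = 0
    · exact (eqw x u (hx.trans hu.symm)).le
    · exact (ltw x u hx hu).le

theorem ncard_lv_zero (hc : RadialCoordinates G H ε a lv ix) :
    {x | lv x = 0}.ncard = a 1 := by
  have h := hc.sum_eq (fun c _ => if c = 0 then 1 else 0)
  rw [sum_range_succ', ← card_filter] at h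
  simpa [Set.ncard_eq_toFinset_card'] using h

theorem centerEps_eq (hc : RadialCoordinates G H ε a lv ix) : G.centerEps = ε := by
  rw [centerEps, hc.weightCenters_eq, hc.ncard_lv_zero]
  rcases hc.center with ⟨rfl, h⟩ | ⟨rfl, h, -⟩
  · rw [if_neg (by omega)]
  · rw [if_pos h]

theorem isBlock_lv_zero (hc : RadialCoordinates G H ε a lv ix) (h1 : 2 ≤ a 1) :
    G.IsBlock {x | lv x = 0} := by
  have hcl : G.IsClique {x | lv x = 0} := by
    intro x hx y hy hxy
    refine (hc.adj_iff x y).2 ⟨hxy, Or.inl ⟨hx.trans hy.symm, ?_⟩⟩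
    rw [show lv x = 0 from hx]
    exact hc.modEq_zero _ _
  refine ⟨hcl.isTwoConnected hc.exists_lv_eq_zero, fun S hS hsub x hx => ?_⟩
  exact hc.lv_eq_zero_of_isClique h1 (hc.isClique_of_isTwoConnected hS) hsub hx

theorem centralVertices_eq (hc : RadialCoordinates G H ε a lv ix) :
    G.centralVertices = {x | lv x = 0} := by
  have hn := hc.ncard_lv_zero
  ext w
  simp only [centralVertices, hc.weightCenters_eq, Set.mem_ofPred_eq]
  rcases hc.center with ⟨rfl, h⟩ | ⟨rfl, h, -⟩
  · constructor
    · rintro (h' | ⟨-, B, hB, hsub, hw⟩)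
      · rw [h', Set.ncard_singleton] at hn; omega
      · exact hc.lv_eq_zero_of_isClique (by omega) (hc.isClique_of_isTwoConnected hB.1) hsub hw
    · intro hw
      exact Or.inr ⟨by omega, _, hc.isBlock_lv_zero (by omega), subset_rfl, hw⟩
  · rw [h] at hn
    obtain ⟨z, hz⟩ := Set.ncard_eq_one.1 hn
    rw [hz]
    constructor
    · rintro (h' | ⟨h', -⟩)
      · have : w ∈ {x | lv x = 0} := by rw [hz, h']; rfl
        exact this
      · rw [Set.ncard_singleton] at h'; omega
    · intro hw
      have : w ∈ ({z} : Set X) := by rw [← hz]; exact hw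
      exact Or.inl (by rw [Set.mem_singleton_iff.1 this])

theorem level_eq (hc : RadialCoordinates G H ε a lv ix) (x : X) : G.level x = lv x := by
  rw [level, hc.centralVertices_eq]
  obtain ⟨z, hz, hzx⟩ := hc.exists_vertex (Nat.zero_le H) (ix x)
  apply le_antisymm
  · refine (Nat.sInf_le (Set.mem_image_of_mem _ (show z ∈ {x | lv x = 0} from hz))).trans ?_
    have := hc.dist_add_agreement x z
    have := hc.le_agreement (x := x) (y := z) (j := 1) (by omega) hzx.symm
    omega
  · refine le_csInf (Set.Nonempty.image _ ⟨z, hz⟩) ?_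
    rintro _ ⟨y, hy, rfl⟩
    have hy : lv y = 0 := hy
    have := hc.dist_add_agreement x y
    have := hc.agreement_le_two (x := x) hy
    dsimp only
    omega

theorem radioLB_eq (hc : RadialCoordinates G H ε a lv ix) :
    G.radioLB = ((Fintype.card X : ℤ) - 1) * (2 * H + 1) - 2 * (∑ x, lv x : ℕ) + ε := by
  have := hc.diam_add_eps
  rw [radioLB, hc.centerEps_eq, totalLevel]
  simp only [hc.level_eq]
  rw [show (G.diam : ℤ) + ε = 2 * H + 1 by exact_mod_cast this]

end Fintype

end RadialCoordinates

end SimpleGraph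

/-! ### The radio number: lower bound and optimal labeling -/

namespace SimpleGraph

variable {X : Type*}

theorem natAbs_sub_le_labelSpan [Fintype X] (f : X → ℕ) (u v : X) :
    ((f u : ℤ) - f v).natAbs ≤ labelSpan f :=
  Finset.le_sup (f := fun p : X × X => ((f p.1 : ℤ) - (f p.2 : ℤ)).natAbs) (mem_univ (u, v))

namespace RadialCoordinates

variable {G : SimpleGraph X} {H ε : ℕ} {a : ℕ → ℕ} {lv ix : X → ℕ}

theorem diam_sub_dist [Finite X] (hc : RadialCoordinates G H ε a lv ix) (x y : X) :
    (G.diam : ℤ) + 1 - G.dist x y = 2 * H + agreement a lv ix x y - ε - lv x - lv y := by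
  have h1 := hc.diam_add_eps
  have h2 := hc.dist_add_agreement x y
  omega

variable [Fintype X]

/-- Here `u` and `v` are the vertices of `S` with first and last label. Adding vertices in
increasing order of label telescopes the gaps between consecutive ones, and the levels of the two
ends are counted only once. -/
theorem exists_span_ge (hc : RadialCoordinates G H ε a lv ix) {f : X → ℕ}
    (hf : G.IsRadioLabeling f) (S : Finset X) (hS : S.Nonempty) :
    ∃ u ∈ S, ∃ v ∈ S, (2 ≤ #S → u ≠ v) ∧
      ((#S : ℤ) - 1) * (2 * H + 1) - 2 * (∑ x ∈ S, lv x : ℕ) + lv u + lv v ≤ f v - f u := by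
  classical
  induction S using Finset.induction_on_max_value f with
  | empty => exact absurd hS (by simp)
  | insert b S hb hmax ih =>
    rcases S.eq_empty_or_nonempty with rfl | hne
    · exact ⟨b, by simp, b, by simp, by simp, by simp; omega⟩
    · obtain ⟨u, hu, v, hv, -, huv⟩ := ih hne
      refine ⟨u, mem_insert_of_mem hu, b, mem_insert_self _ _, fun _ => ?_, ?_⟩
      · rintro rfl; exact hb hu
      · have h1 := hf b v (by rintro rfl; exact hb hv)
        rw [hc.diam_sub_dist, abs_of_nonneg (by have := hmax v hv; omega)] at h1
        have h2 := hc.eps_lt_agreement b v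
        rw [card_insert_of_notMem hb, sum_insert hb]
        push_cast at huv ⊢
        have h2' : (ε : ℤ) + 1 ≤ agreement a lv ix b v := by exact_mod_cast h2
        linarith

theorem two_le_card (hc : RadialCoordinates G H ε a lv ix) : 2 ≤ Fintype.card X := by
  rw [hc.card_eq]
  rcases hc.center with ⟨rfl, h⟩ | ⟨rfl, h, h2, hH⟩
  · rw [sum_range_succ']
    simp only [mul_zero, zero_add]
    omega
  · have h3 := hc.le_a 3 (by omega)
    have := single_le_sum (f := fun c => a (2 * c + 1)) (s := range (H + 1)) (fun _ _ => Nat.zero_le _)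
      (show 1 ∈ range (H + 1) by rw [Finset.mem_range]; omega)
    simp only [mul_one, Nat.reduceAdd] at this
    omega

theorem radioLB_le_labelSpan (hc : RadialCoordinates G H ε a lv ix) {f : X → ℕ}
    (hf : G.IsRadioLabeling f) : G.radioLB ≤ labelSpan f := by
  have hcard := hc.two_le_card
  obtain ⟨u, -, v, -, hne, h⟩ := hc.exists_span_ge hf univ
    (Finset.card_pos.1 (by rw [card_univ]; omega))
  rw [card_univ] at h hne
  have hspan := natAbs_sub_le_labelSpan f v u
  -- With a single central vertex, two distinct ends cannot both have level `0`.
  have hlv : ε ≤ lv u + lv v := by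
    rcases hc.center with ⟨rfl, h⟩ | ⟨rfl, h1, -⟩
    · exact Nat.zero_le _
    · by_contra hlt
      refine hne hcard (hc.eq_of_modEq (by omega) ?_)
      rw [show lv u = 0 by omega, mul_zero, zero_add, h1]
      exact Nat.modEq_one
  rw [hc.radioLB_eq]
  omega

/-- The number of vertices of level less than `c`. -/
def offset (a : ℕ → ℕ) (c : ℕ) : ℕ :=
  ∑ k ∈ range c, a (2 * k + 1)

theorem offset_succ (a : ℕ → ℕ) (c : ℕ) : offset a (c + 1) = offset a c + a (2 * c + 1) :=
  sum_range_succ _ _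

theorem offset_mono (a : ℕ → ℕ) : Monotone (offset a) :=
  monotone_nat_of_le_succ fun c => by rw [offset_succ]; omega

/-- The position of a vertex in the level order, with the first vertex moved to the end. -/
def position (a : ℕ → ℕ) (H : ℕ) (lv ix : X → ℕ) (x : X) : ℕ :=
  if lv x = 0 ∧ ix x = 0 then offset a (H + 1) else offset a (lv x) + ix x

omit [Fintype X] in
theorem offset_add_lt (hc : RadialCoordinates G H ε a lv ix) (x : X) :
    offset a (lv x) + ix x < offset a (lv x + 1) := by
  rw [offset_succ]
  have := hc.ix_lt x
  omega

omit [Fintype X] in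
theorem offset_add_lt_last (hc : RadialCoordinates G H ε a lv ix) (x : X) :
    offset a (lv x) + ix x < offset a (H + 1) :=
  (hc.offset_add_lt x).trans_le (offset_mono a (by have := hc.lv_le x; omega))

omit [Fintype X] in
theorem offset_add_injective (hc : RadialCoordinates G H ε a lv ix) {x y : X}
    (h : offset a (lv x) + ix x = offset a (lv y) + ix y) : x = y := by
  have hx := hc.offset_add_lt x
  have hy := hc.offset_add_lt y
  rcases lt_trichotomy (lv x) (lv y) with hl | hl | hl
  · have := offset_mono a (show lv x + 1 ≤ lv y from hl)
    omega
  · exact hc.inj x y hl (by rw [hl] at h; omega)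
  · have := offset_mono a (show lv y + 1 ≤ lv x from hl)
    omega

omit [Fintype X] in
theorem position_injective (hc : RadialCoordinates G H ε a lv ix) :
    Function.Injective (position a H lv ix) := by
  intro x y h
  have hx := hc.offset_add_lt_last x
  have hy := hc.offset_add_lt_last y
  unfold position at h
  split_ifs at h with h1 h2 h2
  · exact hc.inj x y (by omega) (by omega)
  · omega
  · omega
  · exact hc.offset_add_injective h

theorem image_position (hc : RadialCoordinates G H ε a lv ix) :
    univ.image (position a H lv ix) = Icc 1 (Fintype.card X) := by
  have hcard : Fintype.card X = offset a (H + 1) := hc.card_eq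
  refine eq_of_subset_of_card_le (fun q hq => ?_) ?_
  · obtain ⟨x, -, rfl⟩ := mem_image.1 hq
    have hx := hc.offset_add_lt_last x
    have hpos := hc.card_pos
    rw [Finset.mem_Icc, hcard]
    unfold position
    split_ifs with h
    · omega
    · refine ⟨?_, hx.le⟩
      by_contra h0
      refine h ⟨?_, by omega⟩
      by_contra hl
      have := offset_mono a (show 1 ≤ lv x by omega)
      have h1 : offset a 1 = a 1 := by simp [offset]
      have := hc.a_pos (j := 1) (by omega)
      omega
  · rw [Nat.card_Icc, card_image_of_injective _ hc.position_injective, card_univ]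
    omega

-- Every level from `j / 2` on has a size divisible by `a j`, so whole levels do not matter modulo
-- `a j`. The vertex moved to the end is covered too: its number is `0` and it is displaced past
-- whole levels.
omit [Fintype X] in
theorem position_modEq (hc : RadialCoordinates G H ε a lv ix) {x : X} {j : ℕ}
    (hj : j ≤ 2 * lv x + 1) :
    position a H lv ix x ≡ offset a (j / 2) + ix x [MOD a j] := by
  have key : ∀ c, j / 2 ≤ c → offset a c ≡ offset a (j / 2) [MOD a j] := by
    intro c hcj
    induction c, hcj using Nat.le_induction with
    | base => rfl
    | succ c hcj ih =>
      rw [offset_succ]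
      exact (ih.add (Nat.modEq_zero_iff_dvd.2 (hc.dvd_of_le (by omega)))).trans (by rfl)
  unfold position
  split_ifs with h
  · rw [h.2]
    exact key _ (by omega)
  · exact (key _ (by omega)).add_right _

-- With agreement `t`, the positions are distinct and congruent modulo `a (t - 1)`, hence at least
-- `a (t - 1) ≥ t - ε` apart.
omit [Fintype X] in
theorem agreement_le_position_sub (hc : RadialCoordinates G H ε a lv ix) {x y : X}
    (h : position a H lv ix x < position a H lv ix y) :
    agreement a lv ix x y + position a H lv ix x ≤ position a H lv ix y + ε := by
  have hpos := hc.agreement_pos x y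
  have hj := (hc.lt_agreement_iff (x := x) (y := y)
    (j := agreement a lv ix x y - 1)).1 (by omega)
  have hle := hc.lv_le x
  have ha := hc.le_a (agreement a lv ix x y - 1) (by omega)
  have hmod := (hc.position_modEq (x := x) (j := agreement a lv ix x y - 1) (by omega)).trans
    ((hj.2.add_left _).trans
      (hc.position_modEq (x := y) (j := agreement a lv ix x y - 1) (by omega)).symm)
  have := Nat.le_of_dvd (by omega) ((Nat.modEq_iff_dvd' h.le).1 hmod)
  omega

/-- The label at position `P` when consecutive positions carry the slacks `s`. -/
def cumulativeLabel (s : ℕ → ℕ) (P : ℕ) : ℕ :=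
  ∑ q ∈ Ico 1 P, (1 + s q + s (q + 1))

theorem cumulativeLabel_succ (s : ℕ → ℕ) {P : ℕ} (hP : 1 ≤ P) :
    cumulativeLabel s (P + 1) = cumulativeLabel s P + (1 + s P + s (P + 1)) :=
  sum_Ico_succ_top hP _

/-- Each step contributes 1, and the slacks at both ends are included. With slack `H - lv`, the
radio condition reduces to comparing `Q - P` with the agreement. -/
theorem cumulativeLabel_add_le (s : ℕ → ℕ) {P Q : ℕ} (hP : 1 ≤ P) (hPQ : P < Q) :
    cumulativeLabel s P + (Q - P) + s P + s Q ≤ cumulativeLabel s Q := by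
  induction Q, hPQ using Nat.le_induction with
  | base => rw [Nat.succ_eq_add_one, cumulativeLabel_succ s hP]; omega
  | succ Q hPQ ih =>
    rw [cumulativeLabel_succ s (by omega)]
    omega

theorem cumulativeLabel_le (s : ℕ → ℕ) {Q p : ℕ} (h : Q ≤ p) :
    cumulativeLabel s Q ≤ cumulativeLabel s p :=
  sum_le_sum_of_subset (Ico_subset_Ico_right h)

theorem cumulativeLabel_total (s : ℕ → ℕ) {p : ℕ} (hp : 1 ≤ p) :
    cumulativeLabel s p + s 1 + s p + 1 = p + 2 * ∑ q ∈ Icc 1 p, s q := by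
  induction p, hp using Nat.le_induction with
  | base => simp [cumulativeLabel]; ring
  | succ p hp ih =>
    rw [cumulativeLabel_succ s hp, sum_Icc_succ_top (by omega)]
    omega

omit [Fintype X] in
theorem exists_slack (hc : RadialCoordinates G H ε a lv ix) :
    ∃ s : ℕ → ℕ, ∀ x, s (position a H lv ix x) + lv x = H := by
  have := hc.nonempty
  refine ⟨fun q => H - lv (Function.invFun (position a H lv ix) q), fun x => ?_⟩
  dsimp only
  rw [Function.leftInverse_invFun hc.position_injective x]
  have := hc.lv_le x
  omega

theorem position_bounds (hc : RadialCoordinates G H ε a lv ix) (x : X) :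
    1 ≤ position a H lv ix x ∧ position a H lv ix x ≤ Fintype.card X := by
  rw [← Finset.mem_Icc, ← hc.image_position]
  exact mem_image_of_mem _ (mem_univ x)

theorem isRadioLabeling_cumulativeLabel (hc : RadialCoordinates G H ε a lv ix) {s : ℕ → ℕ}
    (hs : ∀ x, s (position a H lv ix x) + lv x = H) :
    G.IsRadioLabeling fun x => cumulativeLabel s (position a H lv ix x) := by
  have key : ∀ x y, position a H lv ix x < position a H lv ix y →
      2 * (H : ℤ) + agreement a lv ix x y - ε - lv x - lv y ≤
        (cumulativeLabel s (position a H lv ix y) : ℤ) -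
          cumulativeLabel s (position a H lv ix x) := by
    intro x y h
    have h1 := cumulativeLabel_add_le s (hc.position_bounds x).1 h
    have h2 := hc.agreement_le_position_sub h
    have h3 := hs x
    have h4 := hs y
    omega
  intro x y hxy
  rw [hc.diam_sub_dist]
  rcases lt_or_gt_of_ne (hc.position_injective.ne hxy) with h | h
  · rw [abs_sub_comm]
    exact (key x y h).trans (le_abs_self _)
  · refine le_trans ?_ ((key y x h).trans (le_abs_self _))
    rw [agreement_comm]
    linarith

-- Once vertex `0` of level `0` has moved to the end, the first position holds another central
-- vertex or, if there is none, a vertex of level `1`. The end levels thus sum to exactly `ε`, the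
-- equality case of the lower bound.
omit [Fintype X] in
theorem exists_position_one (hc : RadialCoordinates G H ε a lv ix) :
    ∃ x, position a H lv ix x = 1 ∧ lv x = ε := by
  rcases hc.center with ⟨rfl, h⟩ | ⟨rfl, h, h2, hH⟩
  · obtain ⟨x, hx, hx'⟩ := hc.surj 0 (Nat.zero_le H) 1 (by simp only [mul_zero, zero_add]; omega)
    exact ⟨x, by simp [position, hx, hx', offset], hx⟩
  · obtain ⟨x, hx, hx'⟩ := hc.surj 1 hH 0 (hc.a_pos (by omega))
    exact ⟨x, by simp [position, hx, hx', offset, h], hx⟩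

theorem exists_position_card (hc : RadialCoordinates G H ε a lv ix) :
    ∃ x, position a H lv ix x = Fintype.card X ∧ lv x = 0 := by
  obtain ⟨x, hx, hx'⟩ := hc.surj 0 (Nat.zero_le H) 0 (hc.a_pos (by omega))
  exact ⟨x, by simp [position, hx, hx', hc.card_eq, offset], hx⟩

theorem exists_labeling (hc : RadialCoordinates G H ε a lv ix) :
    ∃ f : X → ℕ, G.IsRadioLabeling f ∧ (labelSpan f : ℤ) ≤ G.radioLB := by
  obtain ⟨s, hs⟩ := hc.exists_slack
  refine ⟨_, hc.isRadioLabeling_cumulativeLabel hs, ?_⟩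
  have hle : labelSpan (fun x => cumulativeLabel s (position a H lv ix x)) ≤
      cumulativeLabel s (Fintype.card X) := by
    refine Finset.sup_le fun p _ => ?_
    have h1 := cumulativeLabel_le s (hc.position_bounds p.1).2
    have h2 := cumulativeLabel_le s (hc.position_bounds p.2).2
    dsimp only
    omega
  have htot := cumulativeLabel_total s hc.card_pos
  obtain ⟨x, hx, hx'⟩ := hc.exists_position_one
  obtain ⟨y, hy, hy'⟩ := hc.exists_position_card
  have hsx := hs x
  have hsy := hs y
  rw [hx, hx'] at hsx
  rw [hy, hy'] at hsy
  have hsum : ∑ q ∈ Icc 1 (Fintype.card X), s q + ∑ x, lv x = Fintype.card X * H := by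
    rw [← hc.image_position, sum_image (hc.position_injective.injOn), ← sum_add_distrib]
    simp [hs]
  rw [hc.radioLB_eq]
  have hle' : (labelSpan (fun x => cumulativeLabel s (position a H lv ix x)) : ℤ) ≤
    cumulativeLabel s (Fintype.card X) := by exact_mod_cast hle
  zify at htot hsx hsy hsum
  push_cast
  linarith

theorem radioNumber_eq (hc : RadialCoordinates G H ε a lv ix) :
    (G.radioNumber : ℤ) = G.radioLB := by
  obtain ⟨f, hf, hle⟩ := hc.exists_labeling
  apply le_antisymm
  · refine le_trans ?_ hle
    exact_mod_cast Nat.sInf_le (s := {s | ∃ f : X → ℕ, G.IsRadioLabeling f ∧ labelSpan f = s})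
      ⟨f, hf, rfl⟩
  · obtain ⟨g, hg, hg'⟩ := Nat.sInf_mem
      (s := {s | ∃ f : X → ℕ, G.IsRadioLabeling f ∧ labelSpan f = s}) ⟨_, f, hf, rfl⟩
    rw [radioNumber, ← hg']
    exact hc.radioLB_le_labelSpan hg

theorem isLowerBoundBlockGraph (hc : RadialCoordinates G H ε a lv ix) :
    G.IsLowerBoundBlockGraph :=
  ⟨hc.isBlockGraph, hc.radioNumber_eq⟩

theorem radioNumber_eq_sum (hc : RadialCoordinates G H ε a lv ix) :
    (G.radioNumber : ℤ) = ((Fintype.card X : ℤ) - 1) * (2 * H + 1)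
      - 2 * ∑ c ∈ range (H + 1), (c : ℤ) * a (2 * c + 1) + ε := by
  rw [hc.radioNumber_eq, hc.radioLB_eq, hc.sum_lv]
  push_cast
  rfl

end RadialCoordinates

end SimpleGraph

/-! ### Layered trees and their numbering -/

namespace SimpleGraph

variable {V : Type*}

theorem Connected.exists_adj_dist_succ {G : SimpleGraph V} (hG : G.Connected) {w v : V}
    (h : G.dist w v ≠ 0) : ∃ u, G.Adj v u ∧ G.dist w u + 1 = G.dist w v := by
  obtain ⟨p, hp⟩ := hG.exists_walk_length_eq_dist v w
  rw [dist_comm] at h ⊢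
  cases p with
  | nil => simp at h
  | @cons _ u _ hadj p =>
    refine ⟨u, hadj, ?_⟩
    have h1 := dist_le p
    have h2 := hG.dist_triangle (u := v) (v := u) (w := w)
    rw [dist_eq_one_iff_adj.2 hadj] at h2
    rw [Walk.length_cons] at hp
    rw [G.dist_comm (u := w) (v := u)]
    omega

/-- Geodesics from `w` to `u₁` and `u₂` extend to paths to `v`; these coincide in a tree, so their
penultimate vertices do. -/
theorem IsTree.eq_of_adj_of_dist_succ {T : SimpleGraph V} (hT : T.IsTree) {w v u₁ u₂ : V}
    (h₁ : T.Adj v u₁) (hd₁ : T.dist w u₁ + 1 = T.dist w v)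
    (h₂ : T.Adj v u₂) (hd₂ : T.dist w u₂ + 1 = T.dist w v) : u₁ = u₂ := by
  obtain ⟨p, hp⟩ := hT.connected.exists_walk_length_eq_dist w u₁
  obtain ⟨q, hq⟩ := hT.connected.exists_walk_length_eq_dist w u₂
  have hp' := (p.concat h₁.symm).isPath_of_length_eq_dist (by rw [Walk.length_concat]; omega)
  have hq' := (q.concat h₂.symm).isPath_of_length_eq_dist (by rw [Walk.length_concat]; omega)
  have := congrArg Walk.penultimate
    (congrArg Subtype.val ((hT.isAcyclic.subsingleton_path w v).elim ⟨_, hp'⟩ ⟨_, hq'⟩))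
  simpa using this

/-- A graph arranged in layers, where each vertex outside layer `0` has exactly one neighbour in
the layer below, its parent, and every edge outside layer `0` joins a vertex to its parent. -/
structure IsLayered (T : SimpleGraph V) (δ : V → ℕ) (par : V → V) : Prop where
  adj_par : ∀ v, δ v ≠ 0 → T.Adj v (par v)
  layer_par : ∀ v, δ v ≠ 0 → δ (par v) + 1 = δ v
  par_eq : ∀ v u, T.Adj v u → δ u + 1 = δ v → par v = u
  adj_cases : ∀ u v, T.Adj u v → δ u + 1 = δ v ∨ δ v + 1 = δ u ∨ (δ u = 0 ∧ δ v = 0)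

theorem exists_isLayered {T : SimpleGraph V} {δ : V → ℕ}
    (hex : ∀ v, δ v ≠ 0 → ∃ u, T.Adj v u ∧ δ u + 1 = δ v)
    (huniq : ∀ v u₁ u₂, T.Adj v u₁ → δ u₁ + 1 = δ v → T.Adj v u₂ → δ u₂ + 1 = δ v → u₁ = u₂)
    (hadj : ∀ u v, T.Adj u v → δ u + 1 = δ v ∨ δ v + 1 = δ u ∨ (δ u = 0 ∧ δ v = 0)) :
    ∃ par, T.IsLayered δ par := by
  have : ∀ v, ∃ u, δ v ≠ 0 → T.Adj v u ∧ δ u + 1 = δ v := fun v => by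
    by_cases h : δ v = 0
    · exact ⟨v, fun h' => absurd h h'⟩
    · obtain ⟨u, hu⟩ := hex v h
      exact ⟨u, fun _ => hu⟩
  choose par hpar using this
  refine ⟨par, fun v hv => (hpar v hv).1, fun v hv => (hpar v hv).2, fun v u hvu hd => ?_, hadj⟩
  have := hpar v (by omega)
  exact huniq v _ _ this.1 this.2 hvu hd

namespace IsTree

variable {T : SimpleGraph V}

theorem exists_isLayered_one (hT : T.IsTree) (w : V) :
    ∃ par, T.IsLayered (T.dist w) par := by
  refine exists_isLayered (fun v hv => hT.connected.exists_adj_dist_succ hv)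
    (fun v u₁ u₂ h₁ hd₁ h₂ hd₂ => hT.eq_of_adj_of_dist_succ h₁ hd₁ h₂ hd₂) fun u v huv => ?_
  have := hT.dist_eq_dist_add_one_of_adj w huv
  omega

/-- The only edge joining the two sides is the root edge. Otherwise `v` would have a second
neighbour nearer to `w`, namely the next vertex on its way to `w'`. -/
theorem dist_eq_zero_of_adj_of_sides (hT : T.IsTree) {w w' u v : V} (hw : T.Adj w w')
    (huv : T.Adj u v) (hu : T.dist w' u = T.dist w u + 1) (hv : T.dist w v = T.dist w' v + 1) :
    T.dist w u = 0 ∧ T.dist w' v = 0 := by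
  have h1 := hT.dist_eq_dist_add_one_of_adj w huv
  have h2 := hT.dist_eq_dist_add_one_of_adj w' huv
  have h3 : T.dist w u = T.dist w' v := by omega
  suffices h : T.dist w' v = 0 from ⟨h3.trans h, h⟩
  by_contra h0
  obtain ⟨z, hvz, hz⟩ := hT.connected.exists_adj_dist_succ h0
  have h4 := hT.dist_eq_dist_add_one_of_adj w hvz
  have h5 : T.dist w z ≤ T.dist w' z + 1 := by
    have := hT.connected.dist_triangle (u := w) (v := w') (w := z)
    rw [dist_eq_one_iff_adj.2 hw] at this
    omega
  have := hT.eq_of_adj_of_dist_succ (w := w) hvz (by omega) huv.symm (by omega)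
  rw [this] at hz
  omega

theorem exists_isLayered_two (hT : T.IsTree) {w w' : V} (hw : T.Adj w w') :
    ∃ par, T.IsLayered (fun v => min (T.dist w v) (T.dist w' v)) par := by
  have side : ∀ v, T.dist w v = T.dist w' v + 1 ∨ T.dist w' v = T.dist w v + 1 := by
    intro v
    have := hT.dist_eq_dist_add_one_of_adj v hw
    rwa [dist_comm (u := v) (v := w), dist_comm (u := v) (v := w')] at this
  have step : ∀ v u, T.Adj v u → (T.dist w v = T.dist w u + 1 ∨ T.dist w u = T.dist w v + 1) ∧
      (T.dist w' v = T.dist w' u + 1 ∨ T.dist w' u = T.dist w' v + 1) := fun v u h =>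
    ⟨hT.dist_eq_dist_add_one_of_adj w h, hT.dist_eq_dist_add_one_of_adj w' h⟩
  refine exists_isLayered (fun v hv => ?_) (fun v u₁ u₂ h₁ hd₁ h₂ hd₂ => ?_) fun u v huv => ?_
  · rcases side v with h | h
    · obtain ⟨u, hu, hd⟩ := hT.connected.exists_adj_dist_succ (w := w') (v := v) (by omega)
      have := step v u hu
      have := side u
      exact ⟨u, hu, by omega⟩
    · obtain ⟨u, hu, hd⟩ := hT.connected.exists_adj_dist_succ (w := w) (v := v) (by omega)
      have := step v u hu
      have := side u
      exact ⟨u, hu, by omega⟩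
  · have s₁ := step v u₁ h₁
    have s₂ := step v u₂ h₂
    rcases side v with h | h
    · exact hT.eq_of_adj_of_dist_succ (w := w') h₁ (by omega) h₂ (by omega)
    · exact hT.eq_of_adj_of_dist_succ (w := w) h₁ (by omega) h₂ (by omega)
  · have s := step u v huv
    have hu := side u
    have hv := side v
    by_cases h : T.dist w' u = T.dist w u + 1 ∧ T.dist w v = T.dist w' v + 1
    · have := hT.dist_eq_zero_of_adj_of_sides hw huv h.1 h.2
      omega
    by_cases h' : T.dist w' v = T.dist w v + 1 ∧ T.dist w u = T.dist w' u + 1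
    · have := hT.dist_eq_zero_of_adj_of_sides hw huv.symm h'.1 h'.2
      omega
    omega

end IsTree

/-- A numbering of the vertices inside each layer, layer `c` having `Q c` vertices, in which the
number of a vertex reduces to that of its parent modulo the size of the parent's layer. -/
structure IsLayerNumbering (δ : V → ℕ) (par : V → V) (h : ℕ) (Q : ℕ → ℕ) (idx : V → ℕ) :
    Prop where
  le : ∀ v, δ v ≤ h
  lt : ∀ v, idx v < Q (δ v)
  inj : ∀ u v, δ u = δ v → idx u = idx v → u = v
  surj : ∀ c, c ≤ h → ∀ k, k < Q c → ∃ v, δ v = c ∧ idx v = k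
  modEq : ∀ v, δ v ≠ 0 → idx v ≡ idx (par v) [MOD Q (δ v - 1)]

/-- The numbering of layer `n` built from a numbering of layer `0` and the ranks of the vertices
among their siblings. -/
def layerIndex (par : V → V) (Q : ℕ → ℕ) (root rank : V → ℕ) : ℕ → V → ℕ
  | 0, v => root v
  | n + 1, v => layerIndex par Q root rank n (par v) + Q n * rank v

theorem exists_childRank [DecidableEq V] (S : Finset V) {k : ℕ} (hS : #S = k) :
    ∃ r : V → ℕ, (∀ u ∈ S, r u < k) ∧ (∀ u ∈ S, ∀ v ∈ S, r u = r v → u = v) ∧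
      ∀ i < k, ∃ u ∈ S, r u = i := by
  let e := S.equivFinOfCardEq hS
  refine ⟨fun u => if hu : u ∈ S then e ⟨u, hu⟩ else 0, ?_, ?_, ?_⟩
  · intro u hu
    simp [hu]
  · intro u hu v hv huv
    simp only [hu, hv, dif_pos] at huv
    simpa using e.injective (Fin.ext huv)
  · intro i hi
    refine ⟨e.symm ⟨i, hi⟩, (e.symm ⟨i, hi⟩).2, ?_⟩
    simp

/-- A mixed-radix expansion: the number modulo `Q n` is that of the parent, and the quotient is the
rank among siblings. Siblings are thus spaced `Q n` apart instead of being consecutive, which keeps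
closely related vertices far apart in the labeling order. -/
theorem exists_isLayerNumbering [Fintype V] [DecidableEq V] {δ : V → ℕ} {par : V → V} {h : ℕ}
    {Q k : ℕ → ℕ} {root : V → ℕ} (hpar : ∀ v, δ v ≠ 0 → δ (par v) + 1 = δ v)
    (hle : ∀ v, δ v ≤ h) (hQ : ∀ c, Q (c + 1) = Q c * k c)
    (hchild : ∀ v, δ v < h → #{u | δ u ≠ 0 ∧ par u = v} = k (δ v))
    (hroot_lt : ∀ v, δ v = 0 → root v < Q 0)
    (hroot_inj : ∀ u v, δ u = 0 → δ v = 0 → root u = root v → u = v)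
    (hroot_surj : ∀ i, i < Q 0 → ∃ v, δ v = 0 ∧ root v = i) :
    ∃ idx, IsLayerNumbering δ par h Q idx := by
  choose! r hr_lt hr_inj hr_surj using fun v (hv : δ v < h) => exists_childRank _ (hchild v hv)
  simp only [mem_filter, Finset.mem_univ, true_and] at hr_lt hr_inj hr_surj
  set I := layerIndex par Q root (fun u => r (par u) u) with hI
  have hIs : ∀ n v, I (n + 1) v = I n (par v) + Q n * r (par v) v := fun n v => rfl
  have hlt : ∀ n v, δ v = n → I n v < Q n := by
    intro n
    induction n with
    | zero => exact hroot_lt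
    | succ n ih =>
      intro v hv
      have h1 := hpar v (by omega)
      have h2 := ih (par v) (by omega)
      have h3 := hr_lt (par v) (by have := hle v; omega) v ⟨by omega, rfl⟩
      rw [show δ (par v) = n by omega] at h3
      rw [hIs, hQ]
      calc I n (par v) + Q n * r (par v) v < Q n + Q n * r (par v) v := by omega
        _ = Q n * (r (par v) v + 1) := by ring
        _ ≤ Q n * k n := Nat.mul_le_mul_left _ h3
  have hinj : ∀ n u v, δ u = n → δ v = n → I n u = I n v → u = v := by
    intro n
    induction n with
    | zero => exact hroot_inj
    | succ n ih =>
      intro u v hu hv huv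
      have h1 := hpar u (by omega)
      have h2 := hpar v (by omega)
      have l1 := hlt n (par u) (by omega)
      have l2 := hlt n (par v) (by omega)
      rw [hIs, hIs] at huv
      have hm := congrArg (· % Q n) huv
      simp only [Nat.add_mul_mod_self_left, Nat.mod_eq_of_lt l1, Nat.mod_eq_of_lt l2] at hm
      have hp := ih _ _ (by omega) (by omega) hm
      rw [hp, Nat.add_left_cancel_iff] at huv
      exact hr_inj (par v) (by have := hle v; omega) u ⟨by omega, hp⟩ v ⟨by omega, rfl⟩
        (Nat.eq_of_mul_eq_mul_left (by omega) huv)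
  have hsurj : ∀ n, n ≤ h → ∀ i, i < Q n → ∃ v, δ v = n ∧ I n v = i := by
    intro n
    induction n with
    | zero => exact fun _ => hroot_surj
    | succ n ih =>
      intro hn i hi
      rw [hQ] at hi
      have hpos : 0 < Q n := Nat.pos_of_ne_zero fun h0 => by simp [h0] at hi
      obtain ⟨p, hp, hpi⟩ := ih (by omega) (i % Q n) (Nat.mod_lt _ hpos)
      obtain ⟨v, ⟨hv, hvp⟩, hvi⟩ := hr_surj p (by omega) (i / Q n)
        (by rw [hp]; exact Nat.div_lt_of_lt_mul hi)
      refine ⟨v, ?_, ?_⟩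
      · have := hpar v hv
        rw [hvp] at this
        omega
      · rw [hIs, hvp, hpi, hvi]
        exact Nat.mod_add_div _ _
  refine ⟨fun v => I (δ v) v, hle, fun v => hlt _ v rfl, fun u v huv h' => ?_, fun c hc i hi => ?_,
    fun v hv => ?_⟩
  · rw [huv] at h'
    exact hinj _ u v huv rfl h'
  · obtain ⟨v, hv, hvi⟩ := hsurj c hc i hi
    exact ⟨v, hv, by rw [hv]; exact hvi⟩
  · have h1 := hpar v hv
    rw [← h1, hIs, Nat.add_sub_cancel]
    exact Nat.add_mul_mod_self_left _ _ _

namespace IsLayered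

variable {T : SimpleGraph V} {δ : V → ℕ} {par : V → V}

theorem card_children [Fintype V] [DecidableEq V] [DecidableRel T.Adj] (hL : T.IsLayered δ par)
    (v : V) :
    #{u | δ u ≠ 0 ∧ par u = v} + #{u | T.Adj v u ∧ δ u ≤ δ v} = T.degree v := by
  rw [← card_neighborFinset_eq_degree, ← card_union_of_disjoint]
  · congr 1
    ext u
    simp only [mem_union, mem_filter, Finset.mem_univ, true_and, mem_neighborFinset]
    constructor
    · rintro (⟨hu, rfl⟩ | h)
      · exact (hL.adj_par u hu).symm
      · exact h.1
    · intro h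
      by_cases hle : δ u ≤ δ v
      · exact Or.inr ⟨h, hle⟩
      · have := hL.adj_cases v u h
        exact Or.inl ⟨by omega, hL.par_eq u v h.symm (by omega)⟩
  · rw [Finset.disjoint_left]
    intro u hu hu'
    simp only [mem_filter, Finset.mem_univ, true_and] at hu hu'
    have := hL.layer_par u hu.1
    rw [hu.2] at this
    omega

theorem lower_neighbors_of_ne_zero [Fintype V] [DecidableEq V] [DecidableRel T.Adj]
    (hL : T.IsLayered δ par) {v : V} (hv : δ v ≠ 0) :
    ({u | T.Adj v u ∧ δ u ≤ δ v} : Finset V) = {par v} := by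
  ext u
  simp only [mem_filter, Finset.mem_univ, true_and, Finset.mem_singleton]
  constructor
  · rintro ⟨h, hle⟩
    have := hL.adj_cases v u h
    exact (hL.par_eq v u h (by omega)).symm
  · rintro rfl
    exact ⟨hL.adj_par v hv, by have := hL.layer_par v hv; omega⟩

theorem parentEdge_injective (hL : T.IsLayered δ par) {u v : V} (hu : δ u ≠ 0) (hv : δ v ≠ 0)
    (h : s(u, par u) = s(v, par v)) : u = v := by
  rcases Sym2.eq_iff.1 h with h | ⟨h1, h2⟩
  · exact h.1
  · have := hL.layer_par u hu
    have := hL.layer_par v hv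
    rw [← h1] at this
    rw [h2] at *
    omega

theorem edge_cases (hL : T.IsLayered δ par) {x : Sym2 V} (hx : x ∈ T.edgeSet) :
    (∃ v, δ v ≠ 0 ∧ x = s(v, par v)) ∨ ∃ u v, T.Adj u v ∧ δ u = 0 ∧ δ v = 0 ∧ x = s(u, v) := by
  induction x with
  | h u v =>
    have hadj : T.Adj u v := hx
    rcases hL.adj_cases u v hadj with h | h | h
    · exact Or.inl ⟨v, by omega, by rw [hL.par_eq v u hadj.symm h, Sym2.eq_swap]⟩
    · exact Or.inl ⟨u, by omega, by rw [hL.par_eq u v hadj h]⟩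
    · exact Or.inr ⟨u, v, hadj, h.1, h.2, rfl⟩

theorem parentEdges_share_iff {h : ℕ} {Q : ℕ → ℕ} {idx : V → ℕ} (hL : T.IsLayered δ par)
    (hN : IsLayerNumbering δ par h Q idx) {u v : V} (huv : u ≠ v) (hu : δ u ≠ 0) (hv : δ v ≠ 0) :
    (∃ z, z ∈ s(u, par u) ∧ z ∈ s(v, par v)) ↔
      (δ u = δ v ∧ idx u ≡ idx v [MOD Q (δ u - 1)]) ∨
        (δ v = δ u + 1 ∧ idx u ≡ idx v [MOD Q (δ u)]) ∨
          (δ u = δ v + 1 ∧ idx u ≡ idx v [MOD Q (δ v)]) := by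
  have mu := hN.modEq u hu
  have mv := hN.modEq v hv
  have lu := hL.layer_par u hu
  have lv := hL.layer_par v hv
  have uniq : ∀ x y, δ x = δ y → idx x ≡ idx y [MOD Q (δ x)] → x = y := fun x y hxy hm =>
    hN.inj x y hxy (hm.eq_of_lt_of_lt (hN.lt x) (hxy ▸ hN.lt y))
  constructor
  · rintro ⟨z, hzu, hzv⟩
    rw [Sym2.mem_iff] at hzu hzv
    rcases hzu with rfl | rfl <;> rcases hzv with hz | hz
    · exact absurd hz huv
    · rw [← hz] at mv lv
      refine Or.inr (Or.inl ⟨lv.symm, ?_⟩)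
      rw [← lv, Nat.add_sub_cancel] at mv
      exact mv.symm
    · rw [hz] at mu lu
      refine Or.inr (Or.inr ⟨lu.symm, ?_⟩)
      rwa [← lu, Nat.add_sub_cancel] at mu
    · rw [hz] at mu lu
      have hd : δ u = δ v := by omega
      exact Or.inl ⟨hd, mu.trans (hd ▸ mv.symm)⟩
  · rintro (⟨hd, hm⟩ | ⟨hd, hm⟩ | ⟨hd, hm⟩)
    · refine ⟨par u, Sym2.mem_mk_right _ _, ?_⟩
      rw [uniq (par u) (par v) (by omega) ?_]
      · exact Sym2.mem_mk_right _ _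
      · rw [show δ (par u) = δ u - 1 by omega]
        rw [← hd] at mv
        exact mu.symm.trans (hm.trans mv)
    · refine ⟨u, Sym2.mem_mk_left _ _, ?_⟩
      rw [uniq u (par v) (by omega) ?_]
      · exact Sym2.mem_mk_right _ _
      · rw [hd, Nat.add_sub_cancel] at mv
        exact hm.trans mv
    · refine ⟨v, ?_, Sym2.mem_mk_left _ _⟩
      rw [uniq v (par u) (by omega) ?_]
      · exact Sym2.mem_mk_right _ _
      · rw [hd, Nat.add_sub_cancel] at mu
        exact hm.symm.trans mu

end IsLayered

end SimpleGraph

/-! ### Radial coordinates on the line graphs -/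

namespace SimpleGraph

variable {V : Type*}

namespace IsLayered

variable {T : SimpleGraph V} {δ : V → ℕ} {par : V → V} {h : ℕ} {Q : ℕ → ℕ} {idx : V → ℕ}

/-- An edge is identified with its lower endpoint `v` and placed at level `δ v - 1`. The moduli are
`Q 0, Q 1, Q 1, Q 2, Q 2, …`: those of even index detect a common parent, those of odd index the
edge itself. -/
theorem exists_radialCoordinates_one (hL : T.IsLayered δ par)
    (hN : IsLayerNumbering δ par h Q idx) (hh : 1 ≤ h)
    (hroot : ∀ u v, T.Adj u v → ¬ (δ u = 0 ∧ δ v = 0)) (hQ0 : Q 0 = 1)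
    (hQd : ∀ c, Q c ∣ Q (c + 1)) (hQ : ∀ c, c ≤ h → 2 * c + 1 ≤ Q c) :
    ∃ lv ix, T.lineGraph.RadialCoordinates (h - 1) 0 (fun j => Q ((j + 1) / 2)) lv ix := by
  have hlow : ∀ x : T.edgeSet, ∃ v, δ v ≠ 0 ∧ x.1 = s(v, par v) := by
    rintro ⟨x, hx⟩
    rcases hL.edge_cases hx with h | ⟨u, v, huv, hu, hv, -⟩
    · exact h
    · exact absurd ⟨hu, hv⟩ (hroot u v huv)
  choose low hlow0 hlow using hlow
  have hinj : ∀ x y, low x = low y → x = y := fun x y hxy =>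
    Subtype.ext (by rw [hlow, hlow, hxy])
  have e1 : ∀ l, (2 * l + 1 + 1) / 2 = l + 1 := fun l => by omega
  have e2 : ∀ l, (2 * l + 1) / 2 = l := fun l => by omega
  refine ⟨fun x => δ (low x) - 1, fun x => idx (low x), ⟨?_, ?_, ?_, ?_, ?_, ?_, ?_, ?_, ?_⟩⟩
  · exact hQ0
  · intro j
    rcases Nat.even_or_odd' j with ⟨c, rfl | rfl⟩
    · simp only [e1, e2]
      exact hQd c
    · rw [show (2 * c + 1 + 1 + 1) / 2 = c + 1 by omega, e1]
  · intro j hj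
    have := hQ ((j + 1) / 2) (by omega)
    omega
  · exact Or.inl ⟨rfl, hQ 1 hh⟩
  · intro x
    have := hN.le (low x)
    omega
  · intro x
    rw [e1, Nat.sub_add_cancel (by have := hlow0 x; omega)]
    exact hN.lt _
  · intro x y hl hi
    have := hlow0 x
    have := hlow0 y
    exact hinj x y (hN.inj _ _ (by omega) hi)
  · intro c hc k hk
    rw [e1] at hk
    obtain ⟨v, hv, hvk⟩ := hN.surj (c + 1) (by omega) k hk
    have hv0 : δ v ≠ 0 := by omega
    have hx : low ⟨s(v, par v), hL.adj_par v hv0⟩ = v :=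
      hL.parentEdge_injective (hlow0 _) hv0 (hlow _).symm
    exact ⟨⟨s(v, par v), hL.adj_par v hv0⟩, by rw [hx, hv]; rfl,
      by rw [hx, hvk]⟩
  · intro x y
    rw [lineGraph_adj_iff_exists]
    refine and_congr_right fun hxy => ?_
    rw [hlow x, hlow y, hL.parentEdges_share_iff hN (fun h => hxy (hinj x y h)) (hlow0 x)
      (hlow0 y)]
    have hx := hlow0 x
    have hy := hlow0 y
    obtain ⟨p, hp⟩ := Nat.exists_eq_succ_of_ne_zero hx
    obtain ⟨q, hq⟩ := Nat.exists_eq_succ_of_ne_zero hy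
    simp only [hp, hq, Nat.succ_eq_add_one, Nat.add_sub_cancel, e1, e2, Nat.add_right_cancel_iff]

/-- The root edge `e` alone forms level `0`, and any other edge takes the layer of its lower
endpoint. The moduli are `1, 1, Q 0, Q 1, Q 1, …`; the jump from `1` to `Q 0 = 2` distinguishes the
two cliques meeting in `e`, one at each root. -/
theorem exists_radialCoordinates_two (hL : T.IsLayered δ par)
    (hN : IsLayerNumbering δ par h Q idx) (hh : 1 ≤ h) {w w' : V} (hw : T.Adj w w')
    (hδw : ∀ v, δ v = 0 ↔ v = w ∨ v = w') (hQ0 : Q 0 = 2)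
    (hQd : ∀ c, Q c ∣ Q (c + 1)) (hQ : ∀ c, c ≤ h → 2 * c + 2 ≤ Q c) :
    ∃ lv ix, T.lineGraph.RadialCoordinates h 1 (fun j => if j < 2 then 1 else Q ((j - 1) / 2))
      lv ix := by
  classical
  set e : T.edgeSet := ⟨s(w, w'), hw⟩ with he
  have hlow : ∀ x : T.edgeSet, x ≠ e → ∃ v, δ v ≠ 0 ∧ x.1 = s(v, par v) := by
    rintro ⟨x, hx⟩ hxe
    rcases hL.edge_cases hx with h | ⟨u, v, huv, hu, hv, rfl⟩
    · exact h
    · refine absurd (Subtype.ext ?_) hxe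
      have := huv.ne
      change s(u, v) = s(w, w')
      rcases (hδw u).1 hu with rfl | rfl <;> rcases (hδw v).1 hv with rfl | rfl
      · exact absurd rfl this
      · rfl
      · exact Sym2.eq_swap
      · exact absurd rfl this
  have : Nonempty V := ⟨w⟩
  choose! low hlow0 hlow using hlow
  have hne : ∀ v, δ v ≠ 0 → s(v, par v) ≠ s(w, w') := by
    intro v hv h
    have : v ∈ s(w, w') := h ▸ Sym2.mem_mk_left _ _
    exact hv ((hδw v).2 (Sym2.mem_iff.1 this))
  have hinj : ∀ x y, x ≠ e → y ≠ e → low x = low y → x = y := fun x y hx hy hxy =>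
    Subtype.ext (by rw [hlow x hx, hlow y hy, hxy])
  set lv : T.edgeSet → ℕ := fun x => if x = e then 0 else δ (low x) with hlv
  set ix : T.edgeSet → ℕ := fun x => if x = e then 0 else idx (low x) with hix
  have lve : lv e = 0 := if_pos rfl
  have ixe : ix e = 0 := if_pos rfl
  have lvn : ∀ x, x ≠ e → lv x = δ (low x) := fun x hx => if_neg hx
  have ixn : ∀ x, x ≠ e → ix x = idx (low x) := fun x hx => if_neg hx
  set a : ℕ → ℕ := fun j => if j < 2 then 1 else Q ((j - 1) / 2) with ha
  have a0 : a 0 = 1 := rfl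
  have a1 : a 1 = 1 := rfl
  have aodd : ∀ l, l ≠ 0 → a (2 * l + 1) = Q l := fun l hl => by
    rw [ha]
    dsimp only
    rw [if_neg (by omega), show (2 * l + 1 - 1) / 2 = l by omega]
  have aeven : ∀ l, l ≠ 0 → a (2 * l) = Q (l - 1) := fun l hl => by
    rw [ha]
    dsimp only
    rw [if_neg (by omega), show (2 * l - 1) / 2 = l - 1 by omega]
  have adj_e : ∀ y, y ≠ e → (T.lineGraph.Adj e y ↔ lv y = 1) := by
    intro y hy
    rw [lineGraph_adj_iff_exists, lvn y hy, hlow y hy]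
    have h0 := hlow0 y hy
    have h1 := hL.layer_par _ h0
    constructor
    · rintro ⟨-, z, hz, hz'⟩
      have hz0 := (hδw z).2 (Sym2.mem_iff.1 hz)
      rcases Sym2.mem_iff.1 hz' with rfl | rfl
      · exact absurd hz0 h0
      · omega
    · intro hy1
      exact ⟨hy.symm, par (low y), Sym2.mem_iff.2 ((hδw _).1 (by omega)), Sym2.mem_mk_right _ _⟩
  have rel_e : ∀ y, y ≠ e → ((lv e = lv y ∧ ix e ≡ ix y [MOD a (2 * lv e)]) ∨
      (lv y = lv e + 1 ∧ ix e ≡ ix y [MOD a (2 * lv e + 1)]) ∨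
      (lv e = lv y + 1 ∧ ix e ≡ ix y [MOD a (2 * lv y + 1)]) ↔ lv y = 1) := by
    intro y hy
    have h0 := hlow0 y hy
    rw [← lvn y hy] at h0
    rw [lve, mul_zero, zero_add, a1]
    constructor
    · rintro (h | h | h) <;> omega
    · intro h
      exact Or.inr (Or.inl ⟨h, Nat.modEq_one⟩)
  refine ⟨lv, ix, ⟨a0, ?_, ?_, Or.inr ⟨rfl, a1, ?_, hh⟩, ?_, ?_, ?_, ?_, ?_⟩⟩
  · intro j
    rcases Nat.even_or_odd' j with ⟨c, rfl | rfl⟩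
    · by_cases hc : c = 0
      · rw [hc]
        exact dvd_rfl
      · rw [aeven c hc, aodd c hc]
        have := hQd (c - 1)
        rwa [Nat.sub_add_cancel (by omega)] at this
    · by_cases hc : c = 0
      · rw [hc]
        exact one_dvd _
      · rw [aodd c hc, show 2 * c + 1 + 1 = 2 * (c + 1) by ring, aeven _ (by omega)]
        rfl
  · intro j hj
    rw [ha]
    dsimp only
    split_ifs with h2
    · omega
    · have := hQ ((j - 1) / 2) (by omega)
      omega
  · exact (aeven 1 one_ne_zero).trans hQ0
  · intro x
    by_cases hx : x = e
    · rw [hx, lve]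
      exact Nat.zero_le _
    · rw [lvn x hx]
      exact hN.le _
  · intro x
    by_cases hx : x = e
    · rw [hx, lve, ixe]
      exact one_pos
    · rw [lvn x hx, ixn x hx, aodd _ (hlow0 x hx)]
      exact hN.lt _
  · intro x y hl hi
    by_cases hx : x = e <;> by_cases hy : y = e
    · rw [hx, hy]
    · rw [hx, lve, lvn y hy] at hl
      exact absurd hl.symm (hlow0 y hy)
    · rw [hy, lve, lvn x hx] at hl
      exact absurd hl (hlow0 x hx)
    · rw [lvn x hx, lvn y hy] at hl
      rw [ixn x hx, ixn y hy] at hi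
      exact hinj x y hx hy (hN.inj _ _ hl hi)
  · intro c hc k hk
    by_cases hc0 : c = 0
    · rw [hc0, mul_zero, zero_add, a1] at hk
      exact ⟨e, by rw [lve, hc0], by rw [ixe]; omega⟩
    · rw [aodd c hc0] at hk
      obtain ⟨v, hv, hvk⟩ := hN.surj c hc k hk
      have hv0 : δ v ≠ 0 := by omega
      set x : T.edgeSet := ⟨s(v, par v), hL.adj_par v hv0⟩ with hx
      have hxe : x ≠ e := fun h => hne v hv0 (congrArg Subtype.val h)
      have hxv : low x = v :=
        hL.parentEdge_injective (hlow0 x hxe) hv0 (hlow x hxe).symm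
      exact ⟨x, by rw [lvn x hxe, hxv, hv], by rw [ixn x hxe, hxv, hvk]⟩
  · intro x y
    by_cases hx : x = e <;> by_cases hy : y = e
    · simp [hx, hy]
    · rw [hx, adj_e y hy, rel_e y hy]
      exact (and_iff_right (Ne.symm hy)).symm
    · rw [hy, T.lineGraph.adj_comm, adj_e x hx, ← rel_e x hx]
      rw [and_iff_right hx]
      constructor
      · rintro (h | h | h)
        · exact Or.inl ⟨h.1.symm, h.1 ▸ h.2.symm⟩
        · exact Or.inr (Or.inr ⟨h.1, h.2.symm⟩)
        · exact Or.inr (Or.inl ⟨h.1, h.2.symm⟩)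
      · rintro (h | h | h)
        · exact Or.inl ⟨h.1.symm, h.1 ▸ h.2.symm⟩
        · exact Or.inr (Or.inr ⟨h.1, h.2.symm⟩)
        · exact Or.inr (Or.inl ⟨h.1, h.2.symm⟩)
    · rw [lineGraph_adj_iff_exists]
      refine and_congr_right fun hxy => ?_
      rw [hlow x hx, hlow y hy, hL.parentEdges_share_iff hN (fun h => hxy (hinj x y hx hy h))
        (hlow0 x hx) (hlow0 y hy), lvn x hx, lvn y hy, ixn x hx, ixn y hy,
        aeven _ (hlow0 x hx), aodd _ (hlow0 x hx), aodd _ (hlow0 y hy)]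

end IsLayered

/-! ### Level-wise regular trees and the explicit formulas -/

/-- The sizes of the layers of a tree with `q` vertices in layer `0` in which every vertex of
layer `c` has `k c` children. -/
def layerSize (q : ℕ) (k : ℕ → ℕ) (c : ℕ) : ℕ :=
  q * ∏ j ∈ range c, k j

theorem layerSize_succ (q : ℕ) (k : ℕ → ℕ) (c : ℕ) :
    layerSize q k (c + 1) = layerSize q k c * k c := by
  rw [layerSize, prod_range_succ, ← mul_assoc, layerSize]

theorem IsTree.card_edgeSet [Fintype V] {T : SimpleGraph V} [DecidableEq V] [DecidableRel T.Adj]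
    (hT : T.IsTree) : (Fintype.card T.edgeSet : ℤ) = Fintype.card V - 1 := by
  have := hT.card_edgeFinset
  rw [edgeFinset_card] at this
  omega

section

variable [Fintype V] [DecidableEq V] {T : SimpleGraph V} [DecidableRel T.Adj] {h : ℕ} {m : ℕ → ℕ}

theorem IsLevelwiseRegularTreeOne.exists_radialCoordinates {w : V}
    (hT : T.IsLevelwiseRegularTreeOne w h m) (hh : 1 ≤ h) (hm : ∀ i, i < h → 3 ≤ m i) :
    ∃ lv ix, T.lineGraph.RadialCoordinates (h - 1) 0
      (fun j => layerSize 1 (fun c => if c = 0 then m 0 else m c - 1) ((j + 1) / 2)) lv ix := by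
  set k : ℕ → ℕ := fun c => if c = 0 then m 0 else m c - 1 with hk
  obtain ⟨par, hL⟩ := hT.isTree.exists_isLayered_one w
  have hzero : ∀ v, T.dist w v = 0 ↔ w = v := fun v => hT.isTree.connected.dist_eq_zero_iff
  have hroot : ∀ u v, T.Adj u v → ¬ (T.dist w u = 0 ∧ T.dist w v = 0) := by
    rintro u v huv ⟨hu, hv⟩
    exact huv.ne (((hzero u).1 hu).symm.trans ((hzero v).1 hv))
  obtain ⟨idx, hN⟩ := exists_isLayerNumbering (h := h) (Q := layerSize 1 k) (k := k)
    (root := fun _ => 0) hL.layer_par hT.dist_le (layerSize_succ 1 k)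
    (fun v hv => by
      have h1 := hL.card_children v
      rw [hT.degree_eq v hv] at h1
      rw [hk]
      dsimp only
      split_ifs with h0
      · have h2 : #{u | T.Adj v u ∧ T.dist w u ≤ T.dist w v} = 0 :=
          card_eq_zero.2 (filter_eq_empty_iff.2 fun u _ hu => hroot v u hu.1 ⟨h0, by omega⟩)
        rwa [h2, add_zero, h0] at h1
      · rw [hL.lower_neighbors_of_ne_zero h0, card_singleton] at h1
        omega)
    (fun _ _ => by simp [layerSize]) (fun u v hu hv _ => ((hzero u).1 hu).symm.trans ((hzero v).1 hv))
    (fun i hi => ⟨w, dist_self, by simp [layerSize] at hi; exact hi.symm⟩)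
  refine hL.exists_radialCoordinates_one hN hh hroot (by simp [layerSize])
    (fun c => by rw [layerSize_succ]; exact dvd_mul_right _ _) fun c hc => ?_
  -- The first layer has `m 0 ≥ 3` vertices, and later layers at least double, which outgrows `2 * c
  -- + 1`.
  induction c with
  | zero => simp [layerSize]
  | succ c ih =>
    have := ih (by omega)
    have hmc := hm c (by omega)
    rw [layerSize_succ, show k c = if c = 0 then m 0 else m c - 1 from rfl]
    split_ifs with h0
    · rw [h0] at hmc ⊢
      simpa [layerSize] using hmc
    · have := Nat.mul_le_mul this (show 2 ≤ m c - 1 by omega)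
      omega

theorem IsLevelwiseRegularTreeTwo.exists_radialCoordinates {w w' : V}
    (hT : T.IsLevelwiseRegularTreeTwo w w' h m) (hh : 1 ≤ h) (hm : ∀ i, i < h → 3 ≤ m i) :
    ∃ lv ix, T.lineGraph.RadialCoordinates h 1
      (fun j => if j < 2 then 1 else layerSize 2 (fun c => m c - 1) ((j - 1) / 2)) lv ix := by
  obtain ⟨par, hL⟩ := hT.isTree.exists_isLayered_two hT.adj
  have hzero : ∀ v, min (T.dist w v) (T.dist w' v) = 0 ↔ v = w ∨ v = w' := fun v => by
    rw [Nat.min_eq_zero_iff, hT.isTree.connected.dist_eq_zero_iff,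
      hT.isTree.connected.dist_eq_zero_iff, eq_comm, eq_comm (a := w')]
  have hne := hT.adj.ne
  obtain ⟨idx, hN⟩ := exists_isLayerNumbering (h := h) (Q := layerSize 2 (fun c => m c - 1))
    (k := fun c => m c - 1) (root := fun v => if v = w then 0 else 1) hL.layer_par hT.dist_le
    (layerSize_succ 2 _)
    (fun v hv => by
      have h1 := hL.card_children v
      rw [hT.degree_eq v hv] at h1
      -- Exactly one neighbour is not a child: the other root if `v` is a root, the parent
      -- otherwise.
      suffices h2 : #{u | T.Adj v u ∧ min (T.dist w u) (T.dist w' u) ≤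
          min (T.dist w v) (T.dist w' v)} = 1 by
        rw [h2] at h1
        omega
      by_cases h0 : min (T.dist w v) (T.dist w' v) = 0
      · rw [h0, card_eq_one]
        simp only [Nat.le_zero, hzero]
        rcases (hzero v).1 h0 with rfl | rfl
        · refine ⟨w', ?_⟩
          ext u
          simp only [mem_filter, Finset.mem_univ, true_and, Finset.mem_singleton]
          exact ⟨fun hu => hu.2.resolve_left hu.1.ne', by rintro rfl; exact ⟨hT.adj, Or.inr rfl⟩⟩
        · refine ⟨w, ?_⟩
          ext u
          simp only [mem_filter, Finset.mem_univ, true_and, Finset.mem_singleton]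
          exact ⟨fun hu => hu.2.resolve_right hu.1.ne', by rintro rfl; exact ⟨hT.adj.symm, Or.inl rfl⟩⟩
      · rw [hL.lower_neighbors_of_ne_zero h0, card_singleton])
    (fun v _ => by simp only [layerSize]; split_ifs <;> simp)
    (fun u v hu hv huv => by
      rcases (hzero u).1 hu with rfl | rfl <;> rcases (hzero v).1 hv with rfl | rfl
      · rfl
      · simp [hne.symm] at huv
      · simp [hne.symm] at huv
      · rfl)
    (fun i hi => by
      have hi : i < 2 := by simpa [layerSize] using hi
      interval_cases i
      · exact ⟨w, (hzero w).2 (Or.inl rfl), if_pos rfl⟩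
      · exact ⟨w', (hzero w').2 (Or.inr rfl), if_neg hne.symm⟩)
  refine hL.exists_radialCoordinates_two hN hh hT.adj hzero (by simp [layerSize])
    (fun c => by rw [layerSize_succ]; exact dvd_mul_right _ _) fun c hc => ?_
  induction c with
  | zero => simp [layerSize]
  | succ c ih =>
    have hmc := hm c (by omega)
    have := Nat.mul_le_mul (ih (by omega)) (show 2 ≤ m c - 1 by omega)
    rw [layerSize_succ]
    omega

theorem cast_layerSize_one (hm : ∀ i, i < h → 3 ≤ m i) {c : ℕ} (hc : c + 1 ≤ h) :
    (layerSize 1 (fun c => if c = 0 then m 0 else m c - 1) (c + 1) : ℤ) =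
      m 0 * ∏ j ∈ Ioo 0 (c + 1), ((m j : ℤ) - 1) := by
  induction c with
  | zero =>
    rw [zero_add, show Ioo 0 1 = (∅ : Finset ℕ) from rfl]
    simp [layerSize]
  | succ c ih =>
    have hmc := hm (c + 1) (by omega)
    have hI : Ioo 0 (c + 1 + 1) = insert (c + 1) (Ioo 0 (c + 1)) := by
      ext j
      simp only [Finset.mem_insert, Finset.mem_Ioo]
      omega
    rw [layerSize_succ, Nat.cast_mul, ih (by omega), if_neg (by omega), hI,
      prod_insert (by simp), Nat.cast_sub (by omega)]
    push_cast
    ring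

theorem cast_layerSize_two (hm : ∀ i, i < h → 3 ≤ m i) {c : ℕ} (hc : c ≤ h) :
    (layerSize 2 (fun c => m c - 1) c : ℤ) = 2 * ∏ j ∈ range c, ((m j : ℤ) - 1) := by
  rw [layerSize, Nat.cast_mul, Nat.cast_prod, Nat.cast_two]
  congr 1
  refine prod_congr rfl fun j hj => ?_
  have := hm j (by rw [Finset.mem_range] at hj; omega)
  rw [Nat.cast_sub (by omega), Nat.cast_one]

theorem sum_Icc_one_eq_sum_range (F : ℕ → ℤ) (n : ℕ) :
    ∑ i ∈ Icc 1 n, F i = ∑ c ∈ range n, F (c + 1) := by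
  induction n with
  | zero => simp
  | succ n ih => rw [sum_Icc_succ_top (by omega), sum_range_succ, ih]

theorem IsLevelwiseRegularTreeOne.lineGraph_radioNumber {w : V}
    (hT : T.IsLevelwiseRegularTreeOne w h m) (hh : 1 ≤ h) (hm : ∀ i, i < h → 3 ≤ m i) :
    T.lineGraph.IsLowerBoundBlockGraph ∧
      (T.lineGraph.radioNumber : ℤ) =
        (2 * (h : ℤ) + 1) * ((Fintype.card V : ℤ) - 1) + 1
          - 2 * ∑ i ∈ Finset.Icc 1 h,
              ((m 0 : ℤ) * (i : ℤ) * ∏ j ∈ Finset.Ioo 0 i, ((m j : ℤ) - 1))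
          - 2 * (h : ℤ) := by
  obtain ⟨lv, ix, hc⟩ := hT.exists_radialCoordinates hh hm
  refine ⟨hc.isLowerBoundBlockGraph, ?_⟩
  have hcard := hT.isTree.card_edgeSet
  obtain ⟨g, rfl⟩ := Nat.exists_eq_add_of_le' hh
  -- Layer `i` of the tree gives level `i - 1` of the line graph; this shift adds each edge once to
  -- the weighted sum.
  have hsum : ∑ i ∈ Icc 1 (g + 1), ((m 0 : ℤ) * (i : ℤ) * ∏ j ∈ Ioo 0 i, ((m j : ℤ) - 1)) =
      ∑ c ∈ range (g + 1), (c : ℤ) * (layerSize 1 (fun c => if c = 0 then m 0 else m c - 1)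
        ((2 * c + 1 + 1) / 2) : ℤ) + Fintype.card T.edgeSet := by
    rw [sum_Icc_one_eq_sum_range, hc.card_eq, Nat.cast_sum, Nat.add_sub_cancel,
      ← sum_add_distrib]
    refine sum_congr rfl fun c hcg => ?_
    rw [Finset.mem_range] at hcg
    rw [show (2 * c + 1 + 1) / 2 = c + 1 by omega, cast_layerSize_one hm (by omega)]
    push_cast
    ring
  rw [hc.radioNumber_eq_sum, hsum, Nat.add_sub_cancel, ← hcard]
  push_cast
  ring

theorem IsLevelwiseRegularTreeTwo.lineGraph_radioNumber {w w' : V}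
    (hT : T.IsLevelwiseRegularTreeTwo w w' h m) (hh : 1 ≤ h) (hm : ∀ i, i < h → 3 ≤ m i) :
    T.lineGraph.IsLowerBoundBlockGraph ∧
      (T.lineGraph.radioNumber : ℤ) =
        (2 * (h : ℤ) + 1) * ((Fintype.card V : ℤ) - 1)
          - 4 * ∑ i ∈ Finset.Icc 1 h,
              ((i : ℤ) * ∏ j ∈ Finset.range i, ((m j : ℤ) - 1))
          - 2 * (h : ℤ) := by
  obtain ⟨lv, ix, hc⟩ := hT.exists_radialCoordinates hh hm
  refine ⟨hc.isLowerBoundBlockGraph, ?_⟩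
  have hcard := hT.isTree.card_edgeSet
  have hsum : ∑ c ∈ range (h + 1), (c : ℤ) * ((if 2 * c + 1 < 2 then 1 else
      layerSize 2 (fun c => m c - 1) ((2 * c + 1 - 1) / 2) : ℕ) : ℤ) =
      2 * ∑ i ∈ Icc 1 h, ((i : ℤ) * ∏ j ∈ range i, ((m j : ℤ) - 1)) := by
    rw [sum_Icc_one_eq_sum_range, sum_range_succ', mul_sum, Nat.cast_zero, zero_mul, add_zero]
    refine sum_congr rfl fun c hcg => ?_
    rw [Finset.mem_range] at hcg
    rw [if_neg (by omega), show (2 * (c + 1) + 1 - 1) / 2 = c + 1 by omega,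
      cast_layerSize_two hm (by omega)]
    ring
  rw [hc.radioNumber_eq_sum, hsum, ← hcard]
  push_cast
  ring

end

end SimpleGraph

theorem mainTheorem12 {V : Type*} [Fintype V] [DecidableEq V] (T : SimpleGraph V)
    [DecidableRel T.Adj] (h : ℕ) (hh : 1 ≤ h) (m : ℕ → ℕ) (hm : ∀ i, i < h → 3 ≤ m i) :
    (∀ w : V, T.IsLevelwiseRegularTreeOne w h m →
      T.lineGraph.IsLowerBoundBlockGraph ∧
      (T.lineGraph.radioNumber : ℤ) =
        (2 * (h : ℤ) + 1) * ((Fintype.card V : ℤ) - 1) + 1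
          - 2 * ∑ i ∈ Finset.Icc 1 h,
              ((m 0 : ℤ) * (i : ℤ) * ∏ j ∈ Finset.Ioo 0 i, ((m j : ℤ) - 1))
          - 2 * (h : ℤ)) ∧
    (∀ w w' : V, T.IsLevelwiseRegularTreeTwo w w' h m →
      T.lineGraph.IsLowerBoundBlockGraph ∧
      (T.lineGraph.radioNumber : ℤ) =
        (2 * (h : ℤ) + 1) * ((Fintype.card V : ℤ) - 1)
          - 4 * ∑ i ∈ Finset.Icc 1 h,
              ((i : ℤ) * ∏ j ∈ Finset.range i, ((m j : ℤ) - 1))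
          - 2 * (h : ℤ)) :=
  ⟨fun _ hT => hT.lineGraph_radioNumber hh hm, fun _ _ hT => hT.lineGraph_radioNumber hh hm⟩
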